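/- Let $n\ge 1$, $r\ge 0$, $0\le n_d\le n$ and $k\ge r+1$ be integers and let $0<\beta<\gamma<\alpha<1$. Let $\mathcal X$ be a finite set of augmented samples consisting of $r+1$ classes with $n$ samples each, write $y(x)$ for the class of $x\in\mathcal X$, and let $\mathbb D_d\subset\mathcal X$ (the difficult-to-learn samples) contain exactly $n_d$ samples of each class. Natural data $\bar x\in\mathbb R^d$ have a distribution $\mathcal P$ and labels $y(\bar x)\in\{1,\dots,r+1\}$ that are class-balanced, $\Pr(y(\bar x)=i)=1/(r+1)$ for every $i$, and $\mathcal A(\cdot\mid\bar x)$ is the distribution on $\mathcal X$ of the augmentations of $\bar x$. Let $w_{x,x'}=\mathbb E_{\bar x\sim\mathcal P}[\mathcal A(x\mid\bar x)\mathcal A(x'\mid\bar x)]$ and $w_x=\sum_{x'}w_{x,x'}$. Assume that $w_{x,x'}=a_{x,x'}/\sum_{u,v\in\mathcal X}a_{u,v}$, where $a_{x,x'}=1$ if $x=x'$; $a_{x,x'}=\alpha$ if $x\ne x'$ and $y(x)=y(x')$; $a_{x,x'}=\gamma$ if $y(x)\neq y(x')$ and $x,x'\in\mathbb D_d$; and $a_{x,x'}=\beta$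 otherwise. Assume also that labels are recoverable from augmentations with error $\delta$: there is $g:\mathcal X\to\{1,\dots,r+1\}$ with $\Pr_{\bar x\sim\mathcal P,\,x\sim\mathcal A(\cdot\mid\bar x)}(g(x)\ne y(\bar x))\le\delta$. Put $c_1=(1-\alpha)+n\alpha+nr\beta+n_dr(\gamma-\beta)$ and $c_2=(1-\alpha)+n\alpha+nr\beta$, and define temperatures $$\tau_{x,x'}=\begin{cases} c_1/c_2, & y(x)=y(x'),\ x,x'\in\mathbb D_d,\\ (c_1/c_2)(\beta/\gamma), & y(x)\ne y(x'),\ x,x'\in\mathbb D_d,\\ \sqrt{c_1}/\sqrt{c_2}, & \text{exactly one of } x,x' \text{ is in } \mathbb D_d,\\ 1, & x,x'\notin\mathbb D_d.\end{cases}$$ Let $f:\mathcal X\to\mathbb R^k$ be any global minimizer of the temperature-scaled spectral contrastive loss $$\mathcal L_{\mathrm T}(f)=-2\sum_{x,x'}w_{x,x'}\frac{f(x)^\top f(x')}{\tau_{x,x'}}+\sum_{x,x'}w_xw_{x'}\Big(\frac{f(x)^\top f(x')}{\tau_{x,x'}}\Big)^2,$$ and let $$\mathcal E_{\mathrm T}=\min_{B\in\mathbb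 R^{(r+1)\times k}}\Pr_{\bar x\sim\mathcal P,\,x\sim\mathcal A(\cdot\mid\bar x)}\big(y(\bar x)\text{ is not the unique maximizer of } i\mapsto (Bf(x))_i\big)$$ be its linear probing error. Then $$\mathcal E_{\mathrm T}\le\frac{4\big[1-(n_d/n)^2+(\gamma/\beta)^2(n_d/n)^2\big]\delta}{1-\dfrac{1-\alpha}{(1-\alpha)+n\alpha+nr\beta}}+8\delta.$$ -/

import Mathlib

open MeasureTheory ProbabilityTheory

namespace TempScaling

noncomputable section

/-- The set of augmented samples: `r + 1` classes with `n` samples in each class.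
The first coordinate of a sample is its class, the second its index in the class. -/
abbrev Sample (r n : ℕ) : Type := Fin (r + 1) × Fin n

/-- The difficult-to-learn samples are the last `nd` samples of each class. -/
abbrev IsDifficult {r n : ℕ} (nd : ℕ) (x : Sample r n) : Prop := n ≤ (x.2 : ℕ) + nd

/-- The (unnormalized) similarity of two augmented samples. -/
def similarity {r n : ℕ} (nd : ℕ) (α β γ : ℝ) (x x' : Sample r n) : ℝ :=
  if x = x' then 1
  else if x.1 = x'.1 then α
  else if IsDifficult nd x ∧ IsDifficult nd x' then γ
  else β

/-- `c₁ = (1 - α) + n α + n r β + n_d r (γ - β)`, the total similarity of a difficult sample. -/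
def c₁ (r n nd : ℕ) (α β γ : ℝ) : ℝ :=
  (1 - α) + n * α + n * r * β + nd * r * (γ - β)

/-- `c₂ = (1 - α) + n α + n r β`, the total similarity of a sample that is not difficult. -/
def c₂ (r n : ℕ) (α β : ℝ) : ℝ :=
  (1 - α) + n * α + n * r * β

/-- The temperature `τ_{x,x'}` of a pair of augmented samples. -/
def temperature {r n : ℕ} (nd : ℕ) (α β γ : ℝ) (x x' : Sample r n) : ℝ :=
  if IsDifficult nd x ∧ IsDifficult nd x' then
    if x.1 = x'.1 then c₁ r n nd α β γ / c₂ r n α β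
    else c₁ r n nd α β γ / c₂ r n α β * (β / γ)
  else if IsDifficult nd x ∨ IsDifficult nd x' then
    √(c₁ r n nd α β γ) / √(c₂ r n α β)
  else 1

section Model

variable {d r n k : ℕ}

/-- The edge weight `w_{x,x'} = 𝔼_{x̄ ∼ P}[A(x | x̄) A(x' | x̄)]` of the augmentation graph:
the probability that two independent augmentations of one natural datum are `x` and `x'`. -/
def edgeWeight (P : Measure (EuclideanSpace ℝ (Fin d)))
    (A : Kernel (EuclideanSpace ℝ (Fin d)) (Sample r n)) (x x' : Sample r n) : ℝ :=
  ∫ xbar, (A xbar).real {x} * (A xbar).real {x'} ∂P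

/-- The vertex weight `w_x = ∑_{x'} w_{x,x'}`, the marginal probability of `x`. -/
def vertexWeight (P : Measure (EuclideanSpace ℝ (Fin d)))
    (A : Kernel (EuclideanSpace ℝ (Fin d)) (Sample r n)) (x : Sample r n) : ℝ :=
  ∑ x', edgeWeight P A x x'

/-- The spectral contrastive loss with temperatures `τ`,
`-2 𝔼_{x,x⁺}[f(x)ᵀf(x⁺) / τ_{x,x⁺}] + 𝔼_{x,x'}[(f(x)ᵀf(x') / τ_{x,x'})²]`,
where the positive pair `(x, x⁺)` has law `w_{x,x⁺}` and `x, x'` are independent with law `w_x`. -/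
def tempLoss (P : Measure (EuclideanSpace ℝ (Fin d)))
    (A : Kernel (EuclideanSpace ℝ (Fin d)) (Sample r n))
    (τ : Sample r n → Sample r n → ℝ) (f : Sample r n → Fin k → ℝ) : ℝ :=
  -2 * ∑ x, ∑ x', edgeWeight P A x x' * ((f x ⬝ᵥ f x') / τ x x') +
    ∑ x, ∑ x', vertexWeight P A x * vertexWeight P A x' * ((f x ⬝ᵥ f x') / τ x x') ^ 2

/-- The linear classifier `x ↦ argmax_i (B f(x))_i` assigns the label `i` to the feature
vector `v = f(x)`. A tie for the largest score counts as no assignment. -/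
def Predicts (B : Matrix (Fin (r + 1)) (Fin k) ℝ) (v : Fin k → ℝ) (i : Fin (r + 1)) : Prop :=
  ∀ j, j ≠ i → (B.mulVec v) j < (B.mulVec v) i

/-- The linear probing error of the features `f`: the smallest probability, over all linear
probes `B`, that the linear classifier fails to predict the label `y(x̄)` from `f(x)`, where
`x̄ ∼ P` and `x ∼ A(· | x̄)`. -/
def linearProbingError (P : Measure (EuclideanSpace ℝ (Fin d)))
    (A : Kernel (EuclideanSpace ℝ (Fin d)) (Sample r n))
    (y : EuclideanSpace ℝ (Fin d) → Fin (r + 1)) (f : Sample r n → Fin k → ℝ) : ℝ :=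
  ⨅ B : Matrix (Fin (r + 1)) (Fin k) ℝ,
    (P.compProd A).real {p | ¬ Predicts B (f p.2) (y p.1)}

end Model

end

end TempScaling

/-!
# The linear probing error of temperature-scaled spectral contrastive learning

After rescaling by the vertex weights, the loss of `f` is, up to a constant, a weighted squared
distance between the Gram matrix `F Fᵀ` of the rescaled features and the matrix `targetGram`
(`tempLoss_eq`). The temperatures are such that this target is block-structured: with `t` the
vector `scaling`, it is `(1 - α) diag(t²)` plus `α - β` times the Gram matrix of the class vectors
(the restrictions of `t` to the classes) plus `β t tᵀ`. All weights are at least one, and those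
that exceed one belong to pairs of samples from different classes.

*The class vectors are nearly linear in the features.* Let `Θ` be the projection onto the
complement of the range of the features. Compressing the error to the range of `Θ` bounds the loss
from below by the trace of `Θ`, with more weight on the samples that are not difficult, plus a
multiple of the squared distance of the class vectors from the range of the features
(`approx_error_lower_bound`). A competitor that reproduces the target exactly between the classes,
and hence ignores the large weights, shows that the minimum exceeds the first term by little
(`exists_class_factor`, `exists_block_gram`). So the minimizer has probes close to the class
vectors (`exists_probe_near_classVector`), and the samples that these probes assign to a wrong
class have small total weight (`sum_misassigned_weight_le`).

*The classes nearly determine the labels.* The joint law of label and class is a multiple of a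
doubly stochastic matrix, and Birkhoff's theorem yields a matching of labels with classes whose
error is at most the Gini impurity of the confusion matrix of the classifier `g` plus twice the
error of `g` (`exists_perm_label_error_le`). The impurity is controlled because two augmentations
of one datum receive different labels from `g` with probability at most twice its error, whereas
the edge weights are bounded below by multiples of products of vertex weights (`cut_inequality`).

Adding both errors, the theorem reduces to the inequality `gini_add_misassigned_le` between real
numbers. The cut bound is used there a second time: if `δ` is small enough for the assertion to be
nontrivial, the similarity between the classes is small compared with that inside the classes.
-/

namespace TempScaling

/-! ### The real inequality behind the bound -/

/-- The inequality that combines the two parts of the error. Here `p` is the proportion of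
difficult samples, `ρ = γ / β`, `a` and `b` are the shares of the own class and of the other
classes in the total similarity of a sample that is not difficult, `σ` is the ratio of the degrees,
`G` is the impurity of the classifier and `Δ` is twice its error. The smallness of `Δ`, together
with the cut bound, forces `b` to be small, so that `a - b / r` is positive. -/
theorem gini_add_misassigned_le {p ρ a b r G Δ σ A : ℝ}
    (hp0 : 0 ≤ p) (hp1 : p ≤ 1) (hρ : 1 < ρ) (ha : 0 < a) (hb : 0 < b) (hab : a + b < 1)
    (hr : 1 ≤ r) (hba : b * ρ ≤ r * a) (hσ : σ = 1 + b * (p * (ρ - 1)))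
    (hA : A = 1 - p ^ 2 + ρ ^ 2 * p ^ 2) (hΔ : 0 ≤ Δ) (hG0 : 0 ≤ G) (hG1 : G * (r + 1) ≤ r)
    (hcut : b / σ * (1 - Δ ^ 2) + (a / σ ^ 2 - b / r / σ) * G ≤ Δ)
    (hT : 2 * A * Δ / (a + b) + 4 * Δ < 1) :
    0 < a - b / r ∧
    G + 2 * σ * (1 - (a + b)) * p ^ 2 * (b * (ρ - 1)) / (a - b / r) ≤
      2 * A * Δ / (a + b) + 3 * Δ := by
  obtain ⟨e, he⟩ : ∃ e, e = p * (ρ - 1) := ⟨_, rfl⟩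
  obtain ⟨m, hm⟩ : ∃ m, m = a + b := ⟨_, rfl⟩
  obtain ⟨ν, hν⟩ : ∃ ν, ν = Δ ^ 2 := ⟨_, rfl⟩
  obtain ⟨b', hb'⟩ : ∃ b', b' = b / r := ⟨_, rfl⟩
  have hAe : A = 1 + e ^ 2 + 2 * p * e := by rw [hA, he]; ring
  rw [← he] at hσ
  rw [← hm] at hT hab ⊢
  rw [← hν, ← hb'] at hcut
  rw [← hb']
  have hm0 : 0 < m := by linarith
  have he0 : 0 ≤ e := by rw [he]; exact mul_nonneg hp0 (by linarith)
  have heρ : e ≤ ρ - 1 := by rw [he]; exact mul_le_of_le_one_left (by linarith) hp1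
  have hb1 : b ≤ 1 := by linarith
  have hpe : 0 ≤ p * e := mul_nonneg hp0 he0
  have hbe : 0 ≤ b * e := mul_nonneg hb.le he0
  have hσ1 : 1 ≤ σ := by linarith
  have hσρ : σ ≤ ρ := by linarith [mul_le_mul hb1 heρ he0 zero_le_one]
  have hσ0 : 0 < σ := by linarith
  have hr0 : 0 < r := by linarith
  have hb'0 : 0 < b' := by rw [hb']; positivity
  have hb'b : b' ≤ b := by rw [hb']; exact div_le_self hb.le hr
  have hb'r : b' * r = b := by rw [hb']; field_simp
  have hb'σ : b' * σ ≤ a := by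
    have h1 : b' * ρ ≤ a := by
      refine le_of_mul_le_mul_right ?_ hr0
      calc b' * ρ * r = b' * r * ρ := by ring
        _ ≤ a * r := by rw [hb'r, mul_comm a]; exact hba
    exact (mul_le_mul_of_nonneg_left hσρ hb'0.le).trans h1
  have hA1 : 1 + e ^ 2 ≤ A := by linarith
  have hA1' : 1 ≤ A := by linarith [sq_nonneg e]
  have hAΔ : 0 ≤ (A - 1) * Δ := mul_nonneg (by linarith) hΔ
  have hmΔ : 0 ≤ m * Δ := by positivity
  -- the smallness of `Δ`
  have hT' : (2 * A + 4 * m) * Δ ≤ m := by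
    have h1 : 2 * A * Δ / m + 4 * Δ = (2 * A + 4 * m) * Δ / m := by field_simp
    rw [h1, div_lt_one hm0] at hT
    exact hT.le
  have hΔm : 2 * Δ ≤ m := by linarith
  have hΔ6 : Δ ≤ 1 / 6 := by
    have h1 : 2 * Δ ≤ m * (1 - 4 * Δ) := by
      linarith
    have h2 : 0 ≤ 1 - 4 * Δ := by
      refine nonneg_of_mul_nonneg_right ?_ hm0
      linarith
    have h3 : m * (1 - 4 * Δ) ≤ 1 * (1 - 4 * Δ) := mul_le_mul_of_nonneg_right hab.le h2
    linarith
  have hν0 : 0 ≤ ν := by rw [hν]; positivity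
  have hνm : ν ≤ m / 12 := by
    rw [hν, sq]
    linarith [mul_le_mul hΔ6 (by linarith : Δ ≤ m / 2) hΔ (by norm_num)]
  have hAν : (2 * A + 4 * m) * ν ≤ m / 6 := by
    rw [hν]
    have : (2 * A + 4 * m) * Δ ^ 2 = (2 * A + 4 * m) * Δ * Δ := by ring
    rw [this]
    linarith [mul_le_mul hT' hΔ6 hΔ hm0.le]
  -- lower bounds for `Δ` coming from the two kinds of cut edges
  have hcut1 : b * (1 - ν) ≤ Δ * σ := by
    have h1 : 0 ≤ (a / σ ^ 2 - b' / σ) * G := by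
      refine mul_nonneg ?_ hG0
      rw [sub_nonneg, div_le_div_iff₀ hσ0 (by positivity)]
      linarith [mul_le_mul_of_nonneg_right hb'σ hσ0.le]
    have h2 : b / σ * (1 - ν) ≤ Δ := by linarith
    rwa [div_mul_eq_mul_div, div_le_iff₀ hσ0] at h2
  -- here `23 / 6 = 4 - 1 / 6`, with `4` from `hT'` and `1 / 6` from `hAν`
  have hN : 2 * A * b ≤ m + m * b * (e - 23 / 6) := by
    have h1 : (2 * A + 4 * m) * (b * (1 - ν)) ≤ m * σ := by
      calc (2 * A + 4 * m) * (b * (1 - ν)) ≤ (2 * A + 4 * m) * (Δ * σ) := by gcongr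
        _ = (2 * A + 4 * m) * Δ * σ := by ring
        _ ≤ m * σ := by gcongr
    have h2 := mul_le_mul_of_nonneg_left hAν hb.le
    rw [hσ] at h1
    linarith
  have hκ : 3 * (b * e) ≤ m := by
    have h1 : 4 * (b * e) ≤ 2 * A * b := by
      linarith [mul_nonneg hb.le (sq_nonneg (e - 1)), mul_le_mul_of_nonneg_right hA1 hb.le]
    have h2 : m * (b * e) ≤ b * e := mul_le_of_le_one_left hbe hab.le
    have h3 : 0 ≤ m * b := by positivity
    linarith
  have hσm : σ ≤ 1 + m / 3 := by linarith
  have hlam : σ ^ 2 * (1 - m) ≤ 1 - ν := by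
    have h1 : σ ^ 2 ≤ (1 + m / 3) ^ 2 := by gcongr
    have h2 : σ ^ 2 * (1 - m) ≤ (1 + m / 3) ^ 2 * (1 - m) :=
      mul_le_mul_of_nonneg_right h1 (by linarith)
    have h3 : 0 ≤ m ^ 2 := by positivity
    have h4 : 0 ≤ m ^ 3 := by positivity
    linarith
  have hgap : 2 * (p * e) * m + m * (e ^ 2 - b * e + 23 / 6 * b) ≤ (a - b) * A := by
    have : (a - b) * A = m * A - 2 * A * b := by rw [hm]; ring
    rw [this]
    have : m * A = m * (1 + e ^ 2 + 2 * p * e) := by rw [hAe]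
    linarith
  have hpos : 0 < m * (e ^ 2 - b * e + 23 / 6 * b) := by
    refine mul_pos hm0 ?_
    have : 0 < b * (23 / 6 - b / 4) := mul_pos hb (by linarith)
    linarith [sq_nonneg (e - b / 2)]
  have habpos : 0 < a - b := by
    have h1 : 0 < (a - b) * A := by linarith [mul_nonneg hpe hm0.le]
    exact pos_of_mul_pos_left h1 (by linarith)
  have hab' : 0 < a - b' := by linarith
  refine ⟨hab', ?_⟩
  -- each of the two terms is at most half of the right-hand side
  have hfail : 2 * σ * (1 - m) * p ^ 2 * (b * (ρ - 1)) / (a - b') ≤ (A / m + 3 / 2) * Δ := by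
    have e1 : 2 * σ * (1 - m) * p ^ 2 * (b * (ρ - 1)) = 2 * σ * (1 - m) * (p * e) * b := by
      rw [he]; ring
    rw [e1]
    have h1 : 2 * σ * (1 - m) * (p * e) * b / (a - b') ≤
        2 * σ * (1 - m) * (p * e) * b / (a - b) := by
      have : 0 ≤ 1 - m := by linarith
      apply div_le_div_of_nonneg_left (by positivity) habpos (by linarith)
    refine h1.trans ?_
    rw [div_le_iff₀ habpos]
    have h2 : 2 * (p * e) * m ≤ (a - b) * (A + 3 / 2 * m) := by
      linarith [mul_nonneg habpos.le hm0.le]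
    have e2 : (A / m + 3 / 2) * Δ * (a - b) = ((a - b) * (A + 3 / 2 * m)) * (Δ * σ) / (m * σ) := by
      field_simp
    rw [e2, le_div_iff₀ (by positivity)]
    have h1ν : 0 ≤ 1 - ν := by linarith
    calc 2 * σ * (1 - m) * (p * e) * b * (m * σ)
        = (2 * (p * e) * m) * b * (σ ^ 2 * (1 - m)) := by ring
      _ ≤ (2 * (p * e) * m) * b * (1 - ν) := by gcongr
      _ = (2 * (p * e) * m) * (b * (1 - ν)) := by ring
      _ ≤ ((a - b) * (A + 3 / 2 * m)) * (Δ * σ) := by gcongr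
  have hgini : G ≤ (A / m + 3 / 2) * Δ := by
    have h1 : G * (b * (1 - 2 * ν) + a / σ) ≤ Δ * σ := by
      have h2 : (b * (1 - ν) + (a / σ - b') * G) ≤ Δ * σ := by
        have := mul_le_mul_of_nonneg_right hcut hσ0.le
        calc _ = (b / σ * (1 - ν) + (a / σ ^ 2 - b' / σ) * G) * σ := by field_simp
          _ ≤ _ := this
      have h3 : G * b + G * b' ≤ b := by
        have h3 : b' * (G * (r + 1)) ≤ b' * r := mul_le_mul_of_nonneg_left hG1 hb'0.le
        have h4 : b' * (G * (r + 1)) = G * (b' * r) + G * b' := by ring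
        rw [h4, hb'r] at h3
        exact h3
      have h1ν : 0 ≤ 1 - ν := by linarith
      have h4 := mul_le_mul_of_nonneg_left h3 h1ν
      have h5 : 0 ≤ ν * G * (b - b') := by
        have : 0 ≤ b - b' := by linarith
        positivity
      linarith
    have h2 : m * σ ≤ (A + 3 / 2 * m) * (b * (1 - 2 * ν) + a / σ) := by
      have h3 : m * (1 - m / 6) / σ ≤ b * (1 - 2 * ν) + a / σ := by
        have h4 : b * (1 - 2 * ν) / σ ≤ b * (1 - 2 * ν) := by
          apply div_le_self _ hσ1
          have : 0 ≤ 1 - 2 * ν := by linarith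
          positivity
        have h5 : m * (1 - m / 6) ≤ b * (1 - 2 * ν) + a := by
          linarith [mul_le_mul hνm (by linarith : b ≤ m) hb.le (by positivity)]
        calc m * (1 - m / 6) / σ ≤ (b * (1 - 2 * ν) + a) / σ := by gcongr
          _ = b * (1 - 2 * ν) / σ + a / σ := by ring
          _ ≤ _ := by linarith
      have h4 : m * σ ≤ (A + 3 / 2 * m) * (m * (1 - m / 6) / σ) := by
        rw [mul_div_assoc', le_div_iff₀ hσ0]
        have h5 : σ * σ ≤ (1 + m / 3) * (1 + m / 3) := by gcongr
        have h6 : (1 + m / 3) * (1 + m / 3) ≤ (A + 3 / 2 * m) * (1 - m / 6) := by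
          have h7 : 0 ≤ (A - 1) * (1 - m / 6) := mul_nonneg (by linarith) (by linarith)
          have h8 : m * m ≤ m := mul_le_of_le_one_left hm0.le hab.le
          linarith
        linarith [mul_le_mul_of_nonneg_left (h5.trans h6) hm0.le]
      refine h4.trans ?_
      gcongr
    have e2 : (A / m + 3 / 2) * Δ = (A + 3 / 2 * m) * (Δ * σ) / (m * σ) := by
      field_simp
    rw [e2, le_div_iff₀ (by positivity)]
    calc G * (m * σ) ≤ G * ((A + 3 / 2 * m) * (b * (1 - 2 * ν) + a / σ)) := by gcongr
      _ = (A + 3 / 2 * m) * (G * (b * (1 - 2 * ν) + a / σ)) := by ring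
      _ ≤ _ := by gcongr
  have e3 : 2 * A * Δ / m + 3 * Δ = 2 * ((A / m + 3 / 2) * Δ) := by ring
  rw [e3]
  linarith

open Matrix

/-! ### Lower bound for low-rank approximation by compression -/

section LowerBound
variable {X ι : Type*} [Fintype X] [Fintype ι]

theorem trace_mul_self_nonneg {A : Matrix X X ℝ} (hA : Aᵀ = A) : 0 ≤ (A * A).trace := by
  have := (posSemidef_conjTranspose_mul_self A).trace_nonneg
  rwa [conjTranspose_eq_transpose_of_trivial, hA] at this

/-- The Frobenius norm does not increase under compression by an orthogonal projection. -/
theorem trace_compress_le {Θ A : Matrix X X ℝ} (hΘ : Θᵀ = Θ) (hΘ2 : Θ * Θ = Θ) (hA : Aᵀ = A) :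
    (Θ * A * Θ * A).trace ≤ (A * A).trace := by
  have hsym : (A - Θ * A * Θ)ᵀ = A - Θ * A * Θ := by
    simp [transpose_sub, transpose_mul, hΘ, hA, Matrix.mul_assoc]
  have h := trace_mul_self_nonneg hsym
  have e1 : (A * (Θ * A * Θ)).trace = (Θ * A * Θ * A).trace := trace_mul_comm _ _
  have e2 : (Θ * A * Θ * (Θ * A * Θ)).trace = (Θ * A * Θ * A).trace := by
    have : Θ * A * Θ * (Θ * A * Θ) = Θ * (A * Θ * A * Θ) := by
      simp only [Matrix.mul_assoc]
      rw [← Matrix.mul_assoc Θ Θ, hΘ2]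
    rw [this, trace_mul_comm]
    have : A * Θ * A * Θ * Θ = A * (Θ * A * Θ) := by
      rw [Matrix.mul_assoc, hΘ2]; simp only [Matrix.mul_assoc]
    rw [this, trace_mul_comm]
  rw [Matrix.sub_mul, Matrix.mul_sub, Matrix.mul_sub, trace_sub, trace_sub, trace_sub, e1, e2] at h
  linarith

theorem trace_mul_vecMulVec_self {Θ : Matrix X X ℝ} (hΘ : Θᵀ = Θ) (hΘ2 : Θ * Θ = Θ) (v : X → ℝ) :
    (Θ * vecMulVec v v).trace = ∑ x, ((Θ *ᵥ v) x) ^ 2 := by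
  have h1 : (Θ * vecMulVec v v).trace = (Θ * vecMulVec v v * Θ).trace := by
    rw [trace_mul_comm (Θ * vecMulVec v v), ← Matrix.mul_assoc, hΘ2]
  rw [h1, mul_vecMulVec, vecMulVec_mul, trace_vecMulVec, dotProduct]
  refine Finset.sum_congr rfl fun x _ => ?_
  have : v ᵥ* Θ = Θ *ᵥ v := by rw [← mulVec_transpose, hΘ]
  rw [this, sq]

variable [DecidableEq X]

/-- The orthogonal projection onto the complement of the column space of `F`. -/
theorem exists_compl_projection {k : ℕ} (F : Matrix X (Fin k) ℝ) :
    ∃ Θ : Matrix X X ℝ, Θᵀ = Θ ∧ Θ * Θ = Θ ∧ Θ * F = 0 ∧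
      (Fintype.card X : ℝ) - k ≤ Θ.trace ∧ 0 ≤ Θ.trace ∧
      ∀ v : X → ℝ, ∃ b : Fin k → ℝ, v - Θ *ᵥ v = F *ᵥ b := by
  classical
  let W : Submodule ℝ (EuclideanSpace ℝ X) := LinearMap.range (toEuclideanLin F)
  let e := stdOrthonormalBasis ℝ W
  let E : Matrix X (Fin (Module.finrank ℝ W)) ℝ := Matrix.of fun x l => (e l : EuclideanSpace ℝ X) x
  have hE : Eᵀ * E = 1 := by
    ext l l'
    have h := orthonormal_iff_ite.mp e.orthonormal l l'
    rw [Submodule.coe_inner, PiLp.inner_apply] at h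
    rw [Matrix.one_apply, ← h, Matrix.mul_apply]
    refine Finset.sum_congr rfl fun x _ => ?_
    rw [RCLike.inner_apply, conj_trivial, mul_comm]
    rfl
  have hdim : Module.finrank ℝ W ≤ k := by
    have := LinearMap.finrank_range_le (toEuclideanLin F)
    simpa using this
  have hdim' : Module.finrank ℝ W ≤ Fintype.card X := by
    have := Submodule.finrank_le W
    simpa using this
  have hfix : ∀ w : EuclideanSpace ℝ X, w ∈ W → E *ᵥ (Eᵀ *ᵥ (w : X → ℝ)) = w := by
    intro w hw
    have h := congrArg (fun z : W => (z : EuclideanSpace ℝ X)) (e.sum_repr ⟨w, hw⟩)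
    funext x
    have h2 := congrArg (fun z : EuclideanSpace ℝ X => z x) h
    simp only [Submodule.coe_sum, Submodule.coe_smul] at h2
    rw [← h2]
    simp only [mulVec, dotProduct, WithLp.ofLp_sum, WithLp.ofLp_smul, Finset.sum_apply,
      Pi.smul_apply, smul_eq_mul]
    refine Finset.sum_congr rfl fun l _ => ?_
    rw [mul_comm]
    congr 1
    rw [e.repr_apply_apply, Submodule.coe_inner, PiLp.inner_apply]
    refine Finset.sum_congr rfl fun x _ => ?_
    rw [RCLike.inner_apply, conj_trivial, mul_comm]
    rfl
  have htr : (1 - E * Eᵀ : Matrix X X ℝ).trace = Fintype.card X - Module.finrank ℝ W := by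
    rw [trace_sub, trace_one, trace_mul_comm, hE, trace_one, Fintype.card_fin]
  refine ⟨1 - E * Eᵀ, ?_, ?_, ?_, ?_, ?_, ?_⟩
  · simp [transpose_sub, transpose_mul]
  · have h : E * Eᵀ * (E * Eᵀ) = E * Eᵀ := by
      rw [Matrix.mul_assoc, ← Matrix.mul_assoc Eᵀ, hE, Matrix.one_mul]
    rw [Matrix.sub_mul, Matrix.mul_sub, Matrix.mul_sub, h]
    simp
  · rw [Matrix.sub_mul, Matrix.one_mul, sub_eq_zero, Matrix.mul_assoc]
    ext x l
    have h := congrFun (hfix (toEuclideanLin F (WithLp.toLp 2 (Pi.single l 1))) ⟨_, rfl⟩) x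
    rw [toLpLin_toLp] at h
    simp only [toLin'_apply, mulVec_mulVec] at h
    rw [mulVec_single_one, mulVec_single_one] at h
    exact h.symm
  · rw [htr]
    have : (Module.finrank ℝ W : ℝ) ≤ k := by exact_mod_cast hdim
    linarith
  · rw [htr]
    have : (Module.finrank ℝ W : ℝ) ≤ Fintype.card X := by exact_mod_cast hdim'
    linarith
  · intro v
    have hmem : WithLp.toLp 2 (E *ᵥ (Eᵀ *ᵥ v)) ∈ W := by
      have : WithLp.toLp 2 (E *ᵥ (Eᵀ *ᵥ v)) = ∑ l, (Eᵀ *ᵥ v) l • (e l : EuclideanSpace ℝ X) := by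
        ext x
        simp [mulVec, dotProduct, E, mul_comm]
      rw [this]
      exact W.sum_mem fun l _ => W.smul_mem _ (e l).2
    obtain ⟨b, hb⟩ := hmem
    refine ⟨b, ?_⟩
    have h := congrArg (fun z : EuclideanSpace ℝ X => (z : X → ℝ)) hb
    simp only [toLpLin_apply] at h
    rw [h, Matrix.sub_mulVec, Matrix.one_mulVec, mulVec_mulVec]
    simp

/-- The compression of one orthogonal projection by another has squared Frobenius norm at least the
excess of the sum of their ranks over the dimension. -/
theorem trace_compression_sq_ge {Θ E : Matrix X X ℝ} (hΘ : Θᵀ = Θ) (hΘ2 : Θ * Θ = Θ)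
    (hE : Eᵀ = E) (hE2 : E * E = E) :
    Θ.trace - (Fintype.card X - E.trace) ≤ (Θ * E * Θ * E).trace := by
  have hP : (1 - Θ)ᵀ = 1 - Θ := by simp [transpose_sub, hΘ]
  have hP2 : (1 - Θ) * (1 - Θ) = 1 - Θ := by
    rw [Matrix.sub_mul, Matrix.mul_sub, Matrix.mul_sub, hΘ2]; simp
  have h := trace_compress_le hP hP2 (A := 1 - E) (by simp [transpose_sub, hE])
  have e0 : (1 - E) * (1 - E) = 1 - E := by
    rw [Matrix.sub_mul, Matrix.mul_sub, Matrix.mul_sub, hE2]; simp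
  rw [e0] at h
  have h' := trace_compress_le hE hE2 hP
  rw [hP2] at h'
  have e1 : (E * (1 - Θ) * E * (1 - Θ)).trace
      = E.trace - 2 * (Θ * E).trace + (Θ * E * Θ * E).trace := by
    have e2 : E * (1 - Θ) * E * (1 - Θ) = E - E * Θ - E * Θ * E + E * Θ * E * Θ := by
      simp only [Matrix.mul_sub, Matrix.sub_mul, Matrix.mul_one, hE2]
      abel
    have e3 : (E * Θ * E).trace = (Θ * E).trace := by
      rw [trace_mul_comm, ← Matrix.mul_assoc, hE2, trace_mul_comm]
    have e4 : (E * Θ * E * Θ).trace = (Θ * E * Θ * E).trace := by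
      rw [trace_mul_comm]; simp only [Matrix.mul_assoc]
    rw [e2, trace_add, trace_sub, trace_sub, e3, e4, trace_mul_comm E Θ]
    ring
  have hsym : (1 - Θ - (1 - Θ) * E * (1 - Θ))ᵀ = 1 - Θ - (1 - Θ) * E * (1 - Θ) := by
    simp only [transpose_sub, transpose_mul, hΘ, hE, transpose_one, Matrix.mul_assoc]
  have h3 := trace_mul_self_nonneg hsym
  have e5 : (1 - Θ - (1 - Θ) * E * (1 - Θ)) * (1 - Θ - (1 - Θ) * E * (1 - Θ))
      = (1 - Θ) - (1 - Θ) * E * (1 - Θ) - (1 - Θ) * E * (1 - Θ)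
        + (1 - Θ) * (E * (1 - Θ) * E * (1 - Θ)) := by
    have a1 : (1 - Θ) * ((1 - Θ) * E * (1 - Θ)) = (1 - Θ) * E * (1 - Θ) := by
      simp only [← Matrix.mul_assoc, hP2]
    have a2 : (1 - Θ) * E * (1 - Θ) * (1 - Θ) = (1 - Θ) * E * (1 - Θ) := by
      rw [Matrix.mul_assoc _ (1 - Θ) (1 - Θ), hP2]
    have a3 : (1 - Θ) * E * (1 - Θ) * ((1 - Θ) * E * (1 - Θ))
        = (1 - Θ) * (E * (1 - Θ) * E * (1 - Θ)) := by
      rw [Matrix.mul_assoc ((1 - Θ) * E), a1]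
      simp only [Matrix.mul_assoc]
    rw [Matrix.sub_mul _ _ (1 - Θ - (1 - Θ) * E * (1 - Θ)), Matrix.mul_sub (1 - Θ) (1 - Θ),
      Matrix.mul_sub ((1 - Θ) * E * (1 - Θ)), hP2, a1, a2, a3]
    abel
  have e6 : ((1 - Θ) * E * (1 - Θ)).trace = E.trace - (Θ * E).trace := by
    rw [trace_mul_comm, ← Matrix.mul_assoc, hP2, Matrix.sub_mul, Matrix.one_mul, trace_sub]
  have e7 : ((1 - Θ) * (E * (1 - Θ) * E * (1 - Θ))).trace
      = (E * (1 - Θ) * E * (1 - Θ)).trace := by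
    rw [trace_mul_comm, Matrix.mul_assoc _ (1 - Θ) (1 - Θ), hP2]
  rw [e5, trace_add, trace_sub, trace_sub, e6, e7, e1, trace_sub, trace_one] at h3
  linarith

/-- A lower bound for the squared distance from `G` to a symmetric matrix `M` that `Θ` annihilates,
in terms of the rank of `Θ` and of its action on the rank-one parts of `G`. -/
theorem approx_error_lower_bound {Θ M E : Matrix X X ℝ} (hΘ : Θᵀ = Θ) (hΘ2 : Θ * Θ = Θ)
    (hM : Mᵀ = M) (hΘM : Θ * M = 0) (hE : Eᵀ = E) (hE2 : E * E = E) (hEpos : (1 - E).PosSemidef)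
    {c q α' β : ℝ} (hc : 0 ≤ c) (hq0 : 0 ≤ q) (hq1 : q ≤ 1) (hα : 0 ≤ α') (hβ : 0 ≤ β)
    (u : ι → X → ℝ) (w : X → ℝ) {G : Matrix X X ℝ}
    (hG : G = c • (q • (1 : Matrix X X ℝ) + (1 - q) • E) +
      (α' • ∑ i, vecMulVec (u i) (u i) + β • vecMulVec w w)) :
    c ^ 2 * (q ^ 2 * Θ.trace +
        (1 - q ^ 2) * max 0 (Θ.trace - (Fintype.card X - E.trace))) +
      2 * c * q * α' * ∑ i, ∑ x, ((Θ *ᵥ u i) x) ^ 2 ≤ ((M - G) * (M - G)).trace := by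
  set H : Matrix X X ℝ := α' • ∑ i, vecMulVec (u i) (u i) + β • vecMulVec w w with hH
  have hvv : ∀ v : X → ℝ, (vecMulVec v v).PosSemidef := fun v => by
    simpa using posSemidef_vecMulVec_self_star v
  have hHpos : H.PosSemidef :=
    ((posSemidef_sum _ fun i _ => hvv (u i)).smul hα).add ((hvv w).smul hβ)
  have hHsym : Hᵀ = H := by
    rw [← conjTranspose_eq_transpose_of_trivial]; exact hHpos.isHermitian
  have hGsym : Gᵀ = G := by
    rw [hG]; simp [transpose_add, transpose_smul, hE, hHsym]
  have hMΘ : M * Θ = 0 := by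
    have := congrArg Matrix.transpose hΘM
    rwa [transpose_mul, hM, hΘ, transpose_zero] at this
  -- compressing the error to the kernel of `M` leaves the compression of `G`
  have h1 := trace_compress_le hΘ hΘ2 (A := M - G) (by simp [transpose_sub, hM, hGsym])
  have e1 : (Θ * (M - G) * Θ * (M - G)).trace = (Θ * G * Θ * G).trace := by
    have : Θ * (M - G) * Θ * (M - G) = Θ * G * Θ * G := by
      rw [Matrix.mul_sub Θ, hΘM, zero_sub, Matrix.neg_mul, Matrix.neg_mul, Matrix.mul_sub]
      have : Θ * G * Θ * M = 0 := by rw [Matrix.mul_assoc, hΘM, Matrix.mul_zero]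
      rw [this]; simp
    rw [this]
  rw [e1] at h1
  refine le_trans ?_ h1
  -- expand the compression of `G`
  have tEH : 0 ≤ (Θ * E * Θ * H).trace := by
    have h := (hHpos.mul_mul_conjTranspose_same (E * Θ)).trace_nonneg
    rw [conjTranspose_eq_transpose_of_trivial, transpose_mul, hE, hΘ] at h
    have : (E * Θ * H * (Θ * E)).trace = (Θ * E * Θ * H).trace := by
      have a : E * Θ * H * (Θ * E) = E * (Θ * H * Θ * E) := by simp only [Matrix.mul_assoc]
      have b : Θ * H * Θ * E * E = Θ * H * Θ * E := by rw [Matrix.mul_assoc, hE2]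
      rw [a, trace_mul_comm, b, Matrix.mul_assoc, trace_mul_comm, ← Matrix.mul_assoc]
    rwa [this] at h
  have tHH : 0 ≤ (Θ * H * Θ * H).trace := by
    have h := trace_mul_self_nonneg (A := Θ * H * Θ) (by
      simp [transpose_mul, hΘ, hHsym, Matrix.mul_assoc])
    have : (Θ * H * Θ * (Θ * H * Θ)).trace = (Θ * H * Θ * H).trace := by
      have a : Θ * H * Θ * (Θ * H * Θ) = (Θ * H * Θ * H) * Θ := by
        simp only [Matrix.mul_assoc]
        rw [← Matrix.mul_assoc Θ Θ, hΘ2]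
      rw [a, trace_mul_comm]
      simp only [← Matrix.mul_assoc, hΘ2]
    rwa [this] at h
  have tH : α' * ∑ i, ∑ x, ((Θ *ᵥ u i) x) ^ 2 ≤ (Θ * H).trace := by
    rw [hH, Matrix.mul_add, trace_add, Matrix.mul_smul, Matrix.mul_smul, trace_smul, trace_smul,
      Matrix.mul_sum, trace_sum, trace_mul_vecMulVec_self hΘ hΘ2 w]
    simp only [trace_mul_vecMulVec_self hΘ hΘ2, smul_eq_mul]
    have : 0 ≤ β * ∑ x, ((Θ *ᵥ w) x) ^ 2 := by positivity
    linarith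
  have tE : max 0 (Θ.trace - (Fintype.card X - E.trace)) ≤ (Θ * E).trace := by
    apply max_le
    · have h := (posSemidef_conjTranspose_mul_self (E * Θ)).trace_nonneg
      rw [conjTranspose_eq_transpose_of_trivial, transpose_mul, hE, hΘ] at h
      have : (Θ * E * (E * Θ)).trace = (Θ * E).trace := by
        have a : Θ * E * (E * Θ) = Θ * (E * Θ) := by
          rw [Matrix.mul_assoc, ← Matrix.mul_assoc E E, hE2]
        rw [a, trace_mul_comm, Matrix.mul_assoc, hΘ2, trace_mul_comm]
      rwa [this] at h
    · have h := (hEpos.mul_mul_conjTranspose_same (1 - Θ)).trace_nonneg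
      have hP2 : (1 - Θ) * (1 - Θ) = 1 - Θ := by
        rw [Matrix.sub_mul, Matrix.mul_sub, Matrix.mul_sub, hΘ2]; simp
      rw [conjTranspose_eq_transpose_of_trivial, transpose_sub, transpose_one, hΘ, trace_mul_comm,
        ← Matrix.mul_assoc, hP2, Matrix.sub_mul, Matrix.mul_sub, Matrix.mul_sub] at h
      simp only [trace_sub, trace_one, Matrix.mul_one, Matrix.one_mul] at h
      linarith
  have tEE : max 0 (Θ.trace - (Fintype.card X - E.trace)) ≤ (Θ * E * Θ * E).trace := by
    apply max_le _ (trace_compression_sq_ge hΘ hΘ2 hE hE2)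
    have h := trace_mul_self_nonneg (A := E * Θ * E) (by
      simp [transpose_mul, hΘ, hE, Matrix.mul_assoc])
    have : (E * Θ * E * (E * Θ * E)).trace = (Θ * E * Θ * E).trace := by
      have a : E * Θ * E * (E * Θ * E) = E * (Θ * E * Θ * E) := by
        simp only [Matrix.mul_assoc]
        rw [← Matrix.mul_assoc E E, hE2]
      have b : Θ * E * Θ * E * E = Θ * E * Θ * E := by rw [Matrix.mul_assoc, hE2]
      rw [a, trace_mul_comm, b]
    rwa [this] at h
  have eG : Θ * G = (c * q) • Θ + (c * (1 - q)) • (Θ * E) + Θ * H := by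
    rw [hG, Matrix.mul_add, Matrix.mul_smul, Matrix.mul_add, Matrix.mul_smul, Matrix.mul_smul,
      Matrix.mul_one, smul_add, smul_smul, smul_smul]
  have expand : (Θ * G * Θ * G).trace = c ^ 2 * (q ^ 2 * Θ.trace + 2 * q * (1 - q) * (Θ * E).trace
      + (1 - q) ^ 2 * (Θ * E * Θ * E).trace) + 2 * (c * q) * (Θ * H).trace
      + 2 * (c * (1 - q)) * (Θ * E * Θ * H).trace + (Θ * H * Θ * H).trace := by
    have a0 : Θ * G * Θ * G = (Θ * G) * (Θ * G) := by simp only [Matrix.mul_assoc]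
    have b1 : ∀ A : Matrix X X ℝ, (Θ * A * Θ).trace = (Θ * A).trace := fun A => by
      rw [trace_mul_comm, ← Matrix.mul_assoc, hΘ2]
    have b2 : (Θ * H * Θ * E).trace = (Θ * E * Θ * H).trace := by
      rw [Matrix.mul_assoc (Θ * H), trace_mul_comm, ← Matrix.mul_assoc]
    rw [a0, eG]
    simp only [Matrix.add_mul, Matrix.mul_add, Matrix.smul_mul, Matrix.mul_smul, trace_add,
      trace_smul, smul_eq_mul, ← Matrix.mul_assoc, hΘ2, b1, b2]
    ring
  rw [expand]
  -- the weight `1 - q²` is split as `2 q (1 - q) + (1 - q)²`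
  have k1 : 0 ≤ 1 - q := by linarith
  have k2 : c ^ 2 * (2 * q * (1 - q)) * max 0 (Θ.trace - (Fintype.card X - E.trace))
      ≤ c ^ 2 * (2 * q * (1 - q)) * (Θ * E).trace := by gcongr
  have k3 : c ^ 2 * (1 - q) ^ 2 * max 0 (Θ.trace - (Fintype.card X - E.trace))
      ≤ c ^ 2 * (1 - q) ^ 2 * (Θ * E * Θ * E).trace := by gcongr
  have k4 : 2 * (c * q) * (α' * ∑ i, ∑ x, ((Θ *ᵥ u i) x) ^ 2) ≤ 2 * (c * q) * (Θ * H).trace := by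
    gcongr
  have k5 : 0 ≤ 2 * (c * (1 - q)) * (Θ * E * Θ * H).trace := by positivity
  linarith

end LowerBound

/-! ### Factors of low rank for one class -/

section ClassFactor

theorem sum_sq_diag_add_rank_two {J : Type*} [Fintype J] [DecidableEq J] (g χ τ : J → ℝ)
    (a w : ℝ) :
    ∑ j, ∑ j', ((if j = j' then g j else 0) + a * (χ j * χ j') - w * (τ j * τ j')) ^ 2 =
      ∑ j, g j ^ 2 + 2 * a * ∑ j, g j * χ j ^ 2 - 2 * w * ∑ j, g j * τ j ^ 2 +
      a ^ 2 * (∑ j, χ j ^ 2) ^ 2 - 2 * a * w * (∑ j, χ j * τ j) ^ 2 +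
      w ^ 2 * (∑ j, τ j ^ 2) ^ 2 := by
  have h : ∀ j j', ((if j = j' then g j else 0) + a * (χ j * χ j') - w * (τ j * τ j')) ^ 2 =
      (if j = j' then g j ^ 2 + 2 * a * (g j * χ j ^ 2) - 2 * w * (g j * τ j ^ 2) else 0) +
      (a ^ 2 * (χ j ^ 2 * χ j' ^ 2) - 2 * a * w * ((χ j * τ j) * (χ j' * τ j')) +
        w ^ 2 * (τ j ^ 2 * τ j' ^ 2)) := by
    intro j j'
    split_ifs with hj
    · subst hj; ring
    · ring
  simp only [h, Finset.sum_add_distrib, Finset.sum_sub_distrib, Finset.sum_ite_eq, Finset.mem_univ,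
    if_true, ← Finset.mul_sum, ← Finset.sum_mul]
  ring

/-- An approximate factor of `c diag(τ²)`, supported on columns where `τ = 1`, with `τ` in its
column space. It keeps the diagonal on these columns, with the constant direction replaced by a
multiple of `τ`; the multiple is chosen to minimize the error. -/
theorem exists_head_factor {J : Type*} [Fintype J] [DecidableEq J] {c : ℝ} (hc : 0 < c)
    (τ : J → ℝ) (hτ : ∀ j, 0 < τ j) (S : Finset J) (hS : S.Nonempty) (hSτ : ∀ j ∈ S, τ j = 1) :
    ∃ (Z : Matrix J J ℝ) (q : J → ℝ), (∀ j, ∀ l ∉ S, Z j l = 0) ∧ Z *ᵥ q = τ ∧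
      ∑ j, ∑ j', ((if j = j' then c * τ j ^ 2 else 0) - (Z * Zᵀ) j j') ^ 2 =
        c ^ 2 * (∑ j, τ j ^ 4 - S.card + 1 - ((∑ j, τ j ^ 4) / ∑ j, τ j ^ 2) ^ 2) := by
  obtain ⟨j₀, hj₀⟩ := hS
  have hκ : (0 : ℝ) < S.card := by exact_mod_cast Finset.card_pos.mpr ⟨j₀, hj₀⟩
  set κ : ℝ := ((S.card : ℕ) : ℝ) with hκdef
  have hT2 : 0 < ∑ j, τ j ^ 2 :=
    Finset.sum_pos (fun j _ => pow_pos (hτ j) 2) ⟨j₀, Finset.mem_univ _⟩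
  have hT4 : 0 < ∑ j, τ j ^ 4 :=
    Finset.sum_pos (fun j _ => pow_pos (hτ j) 4) ⟨j₀, Finset.mem_univ _⟩
  set T2 := ∑ j, τ j ^ 2 with hT2def
  set T4 := ∑ j, τ j ^ 4 with hT4def
  set R := T4 / T2 with hR
  have hR0 : 0 < R := div_pos hT4 hT2
  set χ : J → ℝ := fun j => if j ∈ S then 1 else 0 with hχ
  have hχ2 : ∀ j, χ j ^ 2 = χ j := fun j => by simp only [hχ]; split_ifs <;> norm_num
  have hχτ : ∀ j, χ j * τ j = χ j := fun j => by
    simp only [hχ]; split_ifs with h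
    · rw [hSτ j h, mul_one]
    · simp
  have hχsum : ∑ j, χ j = κ := by simp [hχ, hκdef]
  -- `κ d²` is the coefficient of `τ τᵀ` in `Z Zᵀ` that minimizes the error
  set d : ℝ := √(c * R / (κ * T2)) with hd
  have hd2 : d ^ 2 = c * R / (κ * T2) := Real.sq_sqrt (by positivity)
  have hd0 : 0 < d := Real.sqrt_pos.mpr (by positivity)
  have hs2 : √c ^ 2 = c := Real.sq_sqrt hc.le
  have hδ1 : ∀ j, ∑ l, (if j = l then χ l else 0) = χ j := fun j => by simp
  refine ⟨Matrix.of fun j l => χ l * (√c * ((if j = l then 1 else 0) - χ j / κ) + d * τ j),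
    fun _ => 1 / (κ * d), ?_, ?_, ?_⟩
  · intro j l hl
    simp [hχ, hl]
  · funext j
    have : ∀ l, χ l * (√c * ((if j = l then 1 else 0) - χ j / κ) + d * τ j) * (1 / (κ * d)) =
        (√c * (if j = l then χ l else 0) + (d * τ j - √c * (χ j / κ)) * χ l) * (1 / (κ * d)) := by
      intro l; split_ifs <;> ring
    simp only [mulVec, dotProduct, Matrix.of_apply, this, ← Finset.sum_mul,
      Finset.sum_add_distrib, ← Finset.mul_sum, hδ1, hχsum]
    field_simp
    ring
  · have hZ : ∀ j j', ((Matrix.of fun j l =>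
          χ l * (√c * ((if j = l then 1 else 0) - χ j / κ) + d * τ j)) *
        (Matrix.of fun j l =>
          χ l * (√c * ((if j = l then 1 else 0) - χ j / κ) + d * τ j))ᵀ : Matrix J J ℝ) j j' =
        (if j = j' then c * χ j else 0) - c / κ * (χ j * χ j') + c * R / T2 * (τ j * τ j') := by
      intro j j'
      have e1 : ∀ l, χ l * (√c * ((if j = l then 1 else 0) - χ j / κ) + d * τ j) *
          (χ l * (√c * ((if j' = l then 1 else 0) - χ j' / κ) + d * τ j')) =
          √c ^ 2 * (if j = l then (if j = j' then χ l else 0) else 0)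
          + √c * (d * τ j' - √c * (χ j' / κ)) * (if j = l then χ l else 0)
          + √c * (d * τ j - √c * (χ j / κ)) * (if j' = l then χ l else 0)
          + (d * τ j - √c * (χ j / κ)) * (d * τ j' - √c * (χ j' / κ)) * χ l := by
        intro l
        have h2 : χ l * χ l = χ l := by rw [← sq, hχ2]
        have e2 : ∀ a b : ℝ, χ l * a * (χ l * b) = χ l * (a * b) := fun a b => by
          calc χ l * a * (χ l * b) = (χ l * χ l) * (a * b) := by ring
            _ = _ := by rw [h2]
        rw [e2]
        by_cases h3 : j = l
        · subst h3
          by_cases h4 : j = j'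
          · subst h4; simp; ring
          · have h5 : ¬ j' = j := fun h => h4 h.symm
            simp [h4, h5]; ring
        · by_cases h4 : j' = l
          · subst h4; simp [h3]; ring
          · simp [h3, h4]; ring
      rw [Matrix.mul_apply]
      simp only [transpose_apply, Matrix.of_apply, e1, Finset.sum_add_distrib, ← Finset.mul_sum,
        hδ1, hχsum, hs2]
      have e3 : ∑ l, (if j = l then (if j = j' then χ l else 0) else 0)
          = if j = j' then χ j else 0 := by simp
      rw [e3]
      have e4 : c * R / T2 * (τ j * τ j') = κ * d ^ 2 * (τ j * τ j') := by
        rw [hd2]; field_simp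
      rw [e4]
      have e5 : (if j = j' then c * χ j else 0) = c * (if j = j' then χ j else 0) := by
        split_ifs <;> simp
      rw [e5]
      have e6 : √c * √c = c := by rw [← sq, hs2]
      field_simp
      linear_combination (χ j * χ j' * (-1)) * e6
    have herr : ∀ j j', ((if j = j' then c * τ j ^ 2 else 0) -
        ((Matrix.of fun j l =>
          χ l * (√c * ((if j = l then 1 else 0) - χ j / κ) + d * τ j)) *
        (Matrix.of fun j l =>
          χ l * (√c * ((if j = l then 1 else 0) - χ j / κ) + d * τ j))ᵀ : Matrix J J ℝ) j j') ^ 2 =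
        c ^ 2 * ((if j = j' then τ j ^ 2 - χ j else 0) + 1 / κ * (χ j * χ j')
          - R / T2 * (τ j * τ j')) ^ 2 := by
      intro j j'
      rw [hZ, ← mul_pow]
      congr 1
      split_ifs <;> ring
    simp only [herr, ← Finset.mul_sum]
    rw [sum_sq_diag_add_rank_two]
    congr 1
    have hχτ2 : ∀ j, χ j * τ j ^ 2 = χ j := fun j => by rw [sq, ← mul_assoc, hχτ, hχτ]
    have s1 : ∑ j, (τ j ^ 2 - χ j) ^ 2 = T4 - κ := by
      rw [hT4def, ← hχsum, ← Finset.sum_sub_distrib]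
      refine Finset.sum_congr rfl fun j _ => ?_
      linear_combination (-2) * hχτ2 j + hχ2 j
    have s2 : ∑ j, (τ j ^ 2 - χ j) * χ j ^ 2 = 0 := by
      refine Finset.sum_eq_zero fun j _ => ?_
      rw [hχ2]
      linear_combination hχτ2 j - hχ2 j
    have s3 : ∑ j, (τ j ^ 2 - χ j) * τ j ^ 2 = T4 - κ := by
      rw [hT4def, ← hχsum, ← Finset.sum_sub_distrib]
      refine Finset.sum_congr rfl fun j _ => ?_
      linear_combination (-1) * hχτ2 j
    rw [s1, s2, s3]
    simp only [hχ2, hχτ, hχsum, ← hT2def]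
    have hRT : T4 = R * T2 := by rw [hR]; field_simp
    rw [hRT]
    field_simp
    ring

/-- An approximate factor of `c diag(τ²)` with `τ` in its column space, in which the columns of a
block where `τ` is constant are merged into one. -/
theorem exists_tail_factor {J : Type*} [Fintype J] [DecidableEq J] {c s : ℝ} (hc : 0 < c)
    (τ : J → ℝ) (C : Finset J) (l₀ : J) (hl₀ : l₀ ∈ C) (hCτ : ∀ j ∈ C, τ j = s) :
    ∃ (Z : Matrix J J ℝ) (q : J → ℝ), (∀ j, ∀ l ∈ C, l ≠ l₀ → Z j l = 0) ∧ Z *ᵥ q = τ ∧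
      ∑ j, ∑ j', ((if j = j' then c * τ j ^ 2 else 0) - (Z * Zᵀ) j j') ^ 2 =
        c ^ 2 * (s ^ 4 * (C.card - 1)) := by
  have hm : (0 : ℝ) < C.card := by exact_mod_cast Finset.card_pos.mpr ⟨l₀, hl₀⟩
  set m : ℝ := ((C.card : ℕ) : ℝ) with hmdef
  set χ : J → ℝ := fun j => if j ∈ C then 1 else 0 with hχ
  have hχ2 : ∀ j, χ j ^ 2 = χ j := fun j => by simp only [hχ]; split_ifs <;> norm_num
  have hχτ : ∀ j, χ j * τ j = χ j * s := fun j => by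
    simp only [hχ]; split_ifs with h
    · rw [hCτ j h]
    · simp
  have hχsum : ∑ j, χ j = m := by simp [hχ, hmdef]
  have hχ0 : χ l₀ = 1 := by simp [hχ, hl₀]
  have hs2 : √c ^ 2 = c := Real.sq_sqrt hc.le
  have hs0 : 0 < √c := Real.sqrt_pos.mpr hc
  have hm2 : √m ^ 2 = m := Real.sq_sqrt hm.le
  have hm0 : 0 < √m := Real.sqrt_pos.mpr hm
  refine ⟨Matrix.of fun j l => (if j = l then √c * τ j * (1 - χ j) else 0) +
      (if l = l₀ then √c * s * χ j / √m else 0),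
    fun l => if l = l₀ then √m / √c else 1 / √c, ?_, ?_, ?_⟩
  · intro j l hl hne
    have : χ l = 1 := by simp [hχ, hl]
    rw [Matrix.of_apply, if_neg hne, add_zero]
    split_ifs with h
    · rw [h, this]; simp
    · rfl
  · funext j
    simp only [mulVec, dotProduct, Matrix.of_apply, add_mul, ite_mul, zero_mul,
      Finset.sum_add_distrib, Finset.sum_ite_eq, Finset.sum_ite_eq', Finset.mem_univ, if_true]
    have h1 : √c * s * χ j / √m * (√m / √c) = s * χ j := by field_simp
    rw [h1]
    by_cases hj : j = l₀
    · rw [hj, hχ0, if_pos rfl, hCτ l₀ hl₀]; simp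
    · rw [if_neg hj]
      have h2 : √c * τ j * (1 - χ j) * (1 / √c) = τ j * (1 - χ j) := by field_simp
      rw [h2]
      linear_combination (-1) * hχτ j
  · have hZ : ∀ j j', ((Matrix.of fun j l => (if j = l then √c * τ j * (1 - χ j) else 0) +
          (if l = l₀ then √c * s * χ j / √m else 0)) *
        (Matrix.of fun j l => (if j = l then √c * τ j * (1 - χ j) else 0) +
          (if l = l₀ then √c * s * χ j / √m else 0))ᵀ : Matrix J J ℝ) j j' =
        (if j = j' then c * (τ j ^ 2 * (1 - χ j)) else 0) + c * s ^ 2 / m * (χ j * χ j') := by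
      intro j j'
      have hzero : ∀ j, (if j = l₀ then √c * τ j * (1 - χ j) else 0) = 0 := by
        intro j
        split_ifs with h
        · rw [h, hχ0]; simp
        · rfl
      have e1 : ∀ l, ((if j = l then √c * τ j * (1 - χ j) else 0) +
          (if l = l₀ then √c * s * χ j / √m else 0)) *
          ((if j' = l then √c * τ j' * (1 - χ j') else 0) +
          (if l = l₀ then √c * s * χ j' / √m else 0)) =
          (if j = l then √c * τ j * (1 - χ j) *
            (if j' = l then √c * τ j' * (1 - χ j') else 0) else 0) +
          (if l = l₀ then √c * s * χ j / √m * (√c * s * χ j' / √m) else 0) := by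
        intro l
        by_cases hl : l = l₀
        · rw [hl, hzero, hzero]
          simp only [if_true, zero_add, mul_zero, ite_self]
        · simp only [if_neg hl, add_zero, ite_mul, zero_mul]
      rw [Matrix.mul_apply]
      simp only [transpose_apply, Matrix.of_apply, e1, Finset.sum_add_distrib, Finset.sum_ite_eq,
        Finset.sum_ite_eq', Finset.mem_univ, if_true]
      have e2 : √c * s * χ j / √m * (√c * s * χ j' / √m) = c * s ^ 2 / m * (χ j * χ j') := by
        rw [← hs2, ← hm2]
        simp only [Real.sqrt_sq hs0.le, Real.sqrt_sq hm0.le]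
        field_simp
      rw [e2]
      congr 1
      by_cases h : j = j'
      · subst h
        simp only [if_true]
        have : (1 - χ j) ^ 2 = 1 - χ j := by linear_combination hχ2 j
        calc √c * τ j * (1 - χ j) * (√c * τ j * (1 - χ j))
            = √c ^ 2 * τ j ^ 2 * (1 - χ j) ^ 2 := by ring
          _ = _ := by rw [this, hs2]; ring
      · have h' : ¬ j' = j := fun h2 => h h2.symm
        simp [h, h']
    have herr : ∀ j j', ((if j = j' then c * τ j ^ 2 else 0) -
        ((Matrix.of fun j l => (if j = l then √c * τ j * (1 - χ j) else 0) +
          (if l = l₀ then √c * s * χ j / √m else 0)) *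
        (Matrix.of fun j l => (if j = l then √c * τ j * (1 - χ j) else 0) +
          (if l = l₀ then √c * s * χ j / √m else 0))ᵀ : Matrix J J ℝ) j j') ^ 2 =
        c ^ 2 * s ^ 4 * ((if j = j' then χ j else 0) + (-(1 / m)) * (χ j * χ j')
          - 0 * (χ j * χ j')) ^ 2 := by
      intro j j'
      rw [hZ]
      have e0 : c ^ 2 * s ^ 4 = (c * s ^ 2) ^ 2 := by ring
      rw [e0, ← mul_pow]
      congr 1
      split_ifs with h
      · linear_combination c * (τ j + s) * hχτ j
      · ring
    simp only [herr, ← Finset.mul_sum]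
    rw [sum_sq_diag_add_rank_two]
    have hχ3 : ∀ j, χ j * χ j = χ j := fun j => by rw [← sq, hχ2]
    simp only [hχ2, hχ3, hχsum]
    field_simp
    ring

/-- An approximate factor, of rank at most `κ`, of the diagonal part of the target in one class,
with the scaling vector in its column space. Its error exceeds the least error for that rank by at
most a term that does not depend on `κ`. -/
theorem exists_class_factor {n nd κ : ℕ} (hκ0 : 1 ≤ κ) (hκn : κ ≤ n)
    {c s : ℝ} (hc : 0 < c) (hs0 : 0 < s) (hs1 : s ≤ 1) (τ : Fin n → ℝ)
    (hτ : ∀ j : Fin n, τ j = if n ≤ (j : ℕ) + nd then s else 1) :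
    ∃ (Z : Matrix (Fin n) (Fin n) ℝ) (q : Fin n → ℝ),
      (∀ j l : Fin n, κ ≤ (l : ℕ) → Z j l = 0) ∧ Z *ᵥ q = τ ∧
      ∑ j, ∑ j', ((if j = j' then c * τ j ^ 2 else 0) - (Z * Zᵀ) j j') ^ 2 ≤
        c ^ 2 * (s ^ 4 * ((n : ℝ) - κ) + (1 - s ^ 4) * max 0 (((n : ℝ) - nd) - κ) +
          (1 - ((∑ j, τ j ^ 4) / ∑ j, τ j ^ 2) ^ 2)) := by
  have hτpos : ∀ j, 0 < τ j := fun j => by rw [hτ]; split_ifs <;> linarith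
  have hτ1 : ∀ j, τ j ≤ 1 := fun j => by rw [hτ]; split_ifs <;> linarith
  have hs4 : s ^ 4 ≤ 1 := pow_le_one₀ hs0.le hs1
  rcases Nat.lt_or_ge (n - nd) κ with hκ | hκ
  · -- only difficult samples lie beyond the first `κ - 1`
    set l₀ : Fin n := ⟨κ - 1, by omega⟩ with hl₀
    set C : Finset (Fin n) := Finset.Ici l₀ with hC
    obtain ⟨Z, q, hZ0, hZq, hZe⟩ := exists_tail_factor (s := s) hc τ C l₀ (by simp [hC]) (by
      intro j hj
      rw [hC, Finset.mem_Ici, Fin.le_def] at hj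
      have : n ≤ (j : ℕ) + nd := by simp only [hl₀] at hj; omega
      rw [hτ, if_pos this])
    refine ⟨Z, q, ?_, hZq, ?_⟩
    · intro j l hl
      refine hZ0 j l ?_ ?_
      · rw [hC, Finset.mem_Ici, Fin.le_def]; simp only [hl₀]; omega
      · intro h; rw [h] at hl; simp only [hl₀] at hl; omega
    · rw [hZe]
      have hcard : (C.card : ℝ) = n - κ + 1 := by
        rw [hC, Fin.card_Ici]
        simp only [hl₀]
        have : n - (κ - 1) = n - κ + 1 := by omega
        rw [this]; push_cast [Nat.cast_sub hκn]; ring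
      rw [hcard]
      have hR : ((∑ j, τ j ^ 4) / ∑ j, τ j ^ 2) ^ 2 ≤ 1 := by
        apply pow_le_one₀
        · positivity
        · apply div_le_one_of_le₀ _ (by positivity)
          refine Finset.sum_le_sum fun j _ => ?_
          exact pow_le_pow_of_le_one (hτpos j).le (hτ1 j) (by norm_num)
      have : 0 ≤ (1 - s ^ 4) * max 0 (((n : ℝ) - nd) - κ) :=
        mul_nonneg (by linarith) (le_max_left _ _)
      refine mul_le_mul_of_nonneg_left ?_ (by positivity)
      linarith
  · -- the first `κ` samples are not difficult
    have hnd : nd ≤ n := by omega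
    set S : Finset (Fin n) := Finset.univ.filter fun j : Fin n => (j : ℕ) < κ with hS
    have hcard : S.card = κ := by
      rw [hS, Fin.card_filter_val_lt]; omega
    obtain ⟨Z, q, hZ0, hZq, hZe⟩ := exists_head_factor hc τ hτpos S
      (Finset.card_pos.mp (by omega)) (by
      intro j hj
      rw [hS, Finset.mem_filter] at hj
      rw [hτ, if_neg (by omega)])
    refine ⟨Z, q, ?_, hZq, ?_⟩
    · intro j l hl
      refine hZ0 j l ?_
      rw [hS, Finset.mem_filter]; omega
    · rw [hZe, hcard]
      have hT4 : ∑ j, τ j ^ 4 = (n - nd) + nd * s ^ 4 := by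
        have h1 : ∀ j : Fin n, τ j ^ 4 = 1 - (if n - nd ≤ (j : ℕ) then (1 - s ^ 4) else 0) := by
          intro j
          rw [hτ]
          by_cases h : n ≤ (j : ℕ) + nd
          · rw [if_pos h, if_pos (by omega)]; ring
          · rw [if_neg h, if_neg (by omega)]; ring
        simp only [h1, Finset.sum_sub_distrib]
        rw [← Finset.sum_filter, Finset.sum_const]
        have : (Finset.univ.filter fun j : Fin n => n - nd ≤ (j : ℕ)).card = nd := by
          have h2 := Finset.card_filter_add_card_filter_not (s := (Finset.univ : Finset (Fin n)))
            (fun j : Fin n => (j : ℕ) < n - nd)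
          simp only [not_lt, Fin.card_filter_val_lt, Finset.card_univ, Fintype.card_fin] at h2
          omega
        rw [Finset.sum_const, this, Finset.card_univ, Fintype.card_fin, nsmul_eq_mul, nsmul_eq_mul]
        ring
      rw [hT4]
      have hκ' : (κ : ℝ) ≤ n - nd := by
        rw [← Nat.cast_sub hnd]; exact_mod_cast hκ
      rw [max_eq_right (by linarith)]
      refine mul_le_mul_of_nonneg_left ?_ (by positivity)
      have : s ^ 4 * ((n : ℝ) - κ) + (1 - s ^ 4) * ((n : ℝ) - nd - κ)
          = (n - nd + nd * s ^ 4) - κ := by ring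
      linarith

end ClassFactor

/-! ### The loss as an approximation error of a Gram matrix -/

section Loss
variable {d r n k nd : ℕ} {α β γ : ℝ}

theorem card_difficult (hnd : nd ≤ n) :
    (Finset.univ.filter fun j : Fin n => n ≤ (j : ℕ) + nd).card = nd := by
  have h2 := Finset.card_filter_add_card_filter_not (s := (Finset.univ : Finset (Fin n)))
    (fun j : Fin n => (j : ℕ) < n - nd)
  simp only [not_lt, Fin.card_filter_val_lt, Finset.card_univ, Fintype.card_fin] at h2
  have h3 : (Finset.univ.filter fun j : Fin n => n ≤ (j : ℕ) + nd) =
      Finset.univ.filter fun j : Fin n => n - nd ≤ (j : ℕ) := by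
    ext j; simp
  rw [h3]
  omega

theorem sum_index_split (hnd : nd ≤ n) (A B : ℝ) :
    ∑ j : Fin n, (if n ≤ (j : ℕ) + nd then A else B) = (n - nd) * B + nd * A := by
  have h1 : ∀ j : Fin n, (if n ≤ (j : ℕ) + nd then A else B) =
      B + (if n ≤ (j : ℕ) + nd then A - B else 0) := by
    intro j; split_ifs <;> ring
  simp only [h1, Finset.sum_add_distrib]
  rw [← Finset.sum_filter, Finset.sum_const, Finset.sum_const, card_difficult hnd, Finset.card_univ,
    Fintype.card_fin, nsmul_eq_mul, nsmul_eq_mul]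
  ring

theorem sum_similarity (hnd : nd ≤ n) (x : Sample r n) :
    ∑ x', similarity nd α β γ x x' =
      if IsDifficult nd x then c₁ r n nd α β γ else c₂ r n α β := by
  obtain ⟨i, j⟩ := x
  have h : ∀ x' : Sample r n, similarity nd α β γ (i, j) x' =
      β + (if i = x'.1 then α - β else 0) + (if (i, j) = x' then 1 - α else 0) +
      (if IsDifficult nd ((i, j) : Sample r n) then
        (if n ≤ (x'.2 : ℕ) + nd then γ - β else 0) -
        (if i = x'.1 then (if n ≤ (x'.2 : ℕ) + nd then γ - β else 0) else 0) else 0) := by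
    intro x'
    simp only [similarity, IsDifficult]
    by_cases h1 : (i, j) = x'
    · have h2 : i = x'.1 := by rw [← h1]
      simp [← h1]
    · by_cases h2 : i = x'.1
      · rw [if_neg h1, if_neg h1, if_pos h2, if_pos h2, if_pos h2]
        simp
      · by_cases h3 : n ≤ (j : ℕ) + nd <;> by_cases h4 : n ≤ (x'.2 : ℕ) + nd <;>
          simp [h1, h2, h3, h4]
  have e1 : ∑ x' : Sample r n, (if n ≤ (x'.2 : ℕ) + nd then γ - β else 0)
      = ((r : ℝ) + 1) * (nd * (γ - β)) := by
    rw [Fintype.sum_prod_type]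
    simp only [sum_index_split hnd, Finset.sum_const, Finset.card_univ, Fintype.card_fin,
      nsmul_eq_mul]
    push_cast; ring
  have e2 : ∀ g : Fin n → ℝ, ∑ x' : Sample r n, (if i = x'.1 then g x'.2 else 0) = ∑ j, g j := by
    intro g
    rw [Fintype.sum_prod_type]
    simp only [Finset.sum_ite_irrel, Finset.sum_const_zero, Finset.sum_ite_eq, Finset.mem_univ,
      if_true]
  simp only [h, Finset.sum_add_distrib]
  rw [e2 (fun _ => α - β)]
  by_cases hD : IsDifficult nd ((i, j) : Sample r n)
  · simp only [if_pos hD, Finset.sum_sub_distrib]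
    rw [e2 (fun j' => if n ≤ (j' : ℕ) + nd then γ - β else 0), e1, sum_index_split hnd]
    simp [c₁]
    ring
  · simp only [if_neg hD]
    simp [c₂]
    ring

theorem sum_sum_similarity (hnd : nd ≤ n) :
    ∑ u : Sample r n, ∑ v : Sample r n, similarity nd α β γ u v =
      (r + 1) * ((n - nd) * c₂ r n α β + nd * c₁ r n nd α β γ) := by
  simp only [sum_similarity hnd]
  rw [Fintype.sum_prod_type]
  simp only [IsDifficult, sum_index_split hnd, Finset.sum_const, Finset.card_univ,
    Fintype.card_fin, nsmul_eq_mul]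
  push_cast; ring

/-- The factor `t_x` that normalizes the samples: the square root of the degree of the samples that
are not difficult, divided by that of `x`. -/
noncomputable def scaling (nd : ℕ) (α β γ : ℝ) (x : Sample r n) : ℝ :=
  if IsDifficult nd x then √(c₂ r n α β) / √(c₁ r n nd α β γ) else 1

/-- The Gram matrix that the rescaled features have to approximate: the similarity matrix, with
the similarity `γ` replaced by `β`, symmetrically normalized by `scaling`. -/
noncomputable def targetGram (nd : ℕ) (α β γ : ℝ) : Matrix (Sample r n) (Sample r n) ℝ :=
  Matrix.of fun x x' => scaling nd α β γ x * scaling nd α β γ x' *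
    ((if x = x' then 1 - α else 0) + (if x.1 = x'.1 then α - β else 0) + β)

/-- The weight with which the loss penalizes the error in the entry `(x, x')` of the Gram
matrix. -/
noncomputable def pairWeight (nd : ℕ) (β γ : ℝ) (x x' : Sample r n) : ℝ :=
  if x.1 ≠ x'.1 ∧ IsDifficult nd x ∧ IsDifficult nd x' then (γ / β) ^ 2 else 1

theorem c₂_pos (hn : 1 ≤ n) (hβ : 0 < β) (hα0 : 0 < α) (hα : α < 1) : 0 < c₂ r n α β := by
  have h1 : (1 : ℝ) ≤ n := by exact_mod_cast hn
  have h2 : 0 ≤ (n : ℝ) * r * β := by positivity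
  unfold c₂
  nlinarith

theorem c₂_le_c₁ (hβγ : β ≤ γ) : c₂ r n α β ≤ c₁ r n nd α β γ := by
  have : 0 ≤ (nd : ℝ) * r * (γ - β) := by
    have : 0 ≤ γ - β := by linarith
    positivity
  unfold c₁ c₂
  linarith

/-- The temperatures replace the similarity `γ` by `β` in the normalized similarity matrix, at the
cost of a weight `(γ / β)²` on the pairs concerned. -/
theorem similarity_div_temperature (hβ : 0 < β) (hγ : 0 < γ) (h2 : 0 < c₂ r n α β)
    (h1 : 0 < c₁ r n nd α β γ) (x x' : Sample r n) :
    similarity nd α β γ x x' / temperature nd α β γ x x' =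
      pairWeight nd β γ x x' * targetGram nd α β γ x x' := by
  have e1 : c₁ r n nd α β γ = √(c₁ r n nd α β γ) ^ 2 := (Real.sq_sqrt h1.le).symm
  have e2 : c₂ r n α β = √(c₂ r n α β) ^ 2 := (Real.sq_sqrt h2.le).symm
  have p1 : 0 < √(c₁ r n nd α β γ) := Real.sqrt_pos.mpr h1
  have p2 : 0 < √(c₂ r n α β) := Real.sqrt_pos.mpr h2
  have hs : similarity nd α β γ x x' = if x.1 = x'.1 then (if x = x' then 1 - α else 0) + α
      else if IsDifficult nd x ∧ IsDifficult nd x' then γ else β := by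
    unfold similarity
    by_cases h : x = x'
    · simp [h]
    · by_cases h' : x.1 = x'.1 <;> simp [h, h']
  have hx : ¬ x.1 = x'.1 → ¬ x = x' := fun h h' => h (congrArg Prod.fst h')
  rw [hs]
  simp only [targetGram, Matrix.of_apply, scaling, pairWeight, temperature]
  generalize √(c₁ r n nd α β γ) = q1 at *
  generalize √(c₂ r n α β) = q2 at *
  rw [e1, e2]
  by_cases a : IsDifficult nd x <;> by_cases b : IsDifficult nd x' <;> by_cases h : x.1 = x'.1
  all_goals
    simp only [a, b, h, hx, and_true, and_false, if_true, if_false,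
      or_true, or_false, not_true, not_false_eq_true, ne_eq]
    try field_simp
    try ring

theorem degree_mul_degree_div_temperature_sq (hβ : 0 < β) (hγ : 0 < γ) (h2 : 0 < c₂ r n α β)
    (h1 : 0 < c₁ r n nd α β γ) (x x' : Sample r n) :
    (if IsDifficult nd x then c₁ r n nd α β γ else c₂ r n α β) *
      (if IsDifficult nd x' then c₁ r n nd α β γ else c₂ r n α β) /
        temperature nd α β γ x x' ^ 2 = c₂ r n α β ^ 2 * pairWeight nd β γ x x' := by
  have e1 : c₁ r n nd α β γ = √(c₁ r n nd α β γ) ^ 2 := (Real.sq_sqrt h1.le).symm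
  have e2 : c₂ r n α β = √(c₂ r n α β) ^ 2 := (Real.sq_sqrt h2.le).symm
  have p1 : 0 < √(c₁ r n nd α β γ) := Real.sqrt_pos.mpr h1
  have p2 : 0 < √(c₂ r n α β) := Real.sqrt_pos.mpr h2
  simp only [pairWeight, temperature]
  generalize √(c₁ r n nd α β γ) = q1 at *
  generalize √(c₂ r n α β) = q2 at *
  rw [e1, e2]
  by_cases a : IsDifficult nd x <;> by_cases b : IsDifficult nd x' <;> by_cases h : x.1 = x'.1
  all_goals
    simp only [a, b, h, and_true, and_false, if_true, if_false,
      or_true, or_false, not_true, not_false_eq_true, ne_eq]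
    try field_simp

/-- The weighted squared distance of a matrix `M` from the target. -/
noncomputable def gramError (nd : ℕ) (α β γ : ℝ) (M : Matrix (Sample r n) (Sample r n) ℝ) : ℝ :=
  ∑ x, ∑ x', pairWeight nd β γ x x' * (M x x' - targetGram nd α β γ x x') ^ 2

theorem vertexWeight_eq {P : Measure (EuclideanSpace ℝ (Fin d))}
    {A : Kernel (EuclideanSpace ℝ (Fin d)) (Sample r n)} (hnd : nd ≤ n) {S : ℝ}
    (hw : ∀ x x', edgeWeight P A x x' = similarity nd α β γ x x' / S) (x : Sample r n) :
    vertexWeight P A x = (if IsDifficult nd x then c₁ r n nd α β γ else c₂ r n α β) / S := by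
  rw [vertexWeight, ← sum_similarity hnd, Finset.sum_div]
  exact Finset.sum_congr rfl fun x' _ => hw x x'

theorem tempLoss_eq {P : Measure (EuclideanSpace ℝ (Fin d))}
    {A : Kernel (EuclideanSpace ℝ (Fin d)) (Sample r n)} (hnd : nd ≤ n) {S : ℝ} (hS : 0 < S)
    (hw : ∀ x x', edgeWeight P A x x' = similarity nd α β γ x x' / S)
    (hβ : 0 < β) (hγ : 0 < γ) (h2 : 0 < c₂ r n α β) (h1 : 0 < c₁ r n nd α β γ)
    (F : Matrix (Sample r n) (Fin k) ℝ) :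
    tempLoss P A (temperature nd α β γ) (fun x l => √S / c₂ r n α β * F x l) =
      (gramError nd α β γ (F * Fᵀ) - ∑ x, ∑ x', pairWeight nd β γ x x' *
        targetGram (r := r) (n := n) nd α β γ x x' ^ 2) / c₂ r n α β ^ 2 := by
  have hdot : ∀ x x' : Sample r n, ((fun l => √S / c₂ r n α β * F x l) ⬝ᵥ
      fun l => √S / c₂ r n α β * F x' l) = S / c₂ r n α β ^ 2 * (F * Fᵀ) x x' := by
    intro x x'
    rw [Matrix.mul_apply, dotProduct, Finset.mul_sum]
    refine Finset.sum_congr rfl fun l _ => ?_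
    rw [transpose_apply]
    have : S = √S ^ 2 := (Real.sq_sqrt hS.le).symm
    calc _ = √S ^ 2 / c₂ r n α β ^ 2 * (F x l * F x' l) := by ring
      _ = _ := by rw [← this]
  rw [tempLoss, gramError, Finset.mul_sum, ← Finset.sum_add_distrib, ← Finset.sum_sub_distrib,
    Finset.sum_div]
  refine Finset.sum_congr rfl fun x _ => ?_
  rw [Finset.mul_sum, ← Finset.sum_add_distrib, ← Finset.sum_sub_distrib, Finset.sum_div]
  refine Finset.sum_congr rfl fun x' _ => ?_
  rw [hdot, hw, vertexWeight_eq hnd hw, vertexWeight_eq hnd hw]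
  have k1 := similarity_div_temperature hβ hγ h2 h1 x x'
  have k2 := degree_mul_degree_div_temperature_sq (nd := nd) hβ hγ h2 h1 x x'
  generalize (F * Fᵀ) x x' = m
  set τ := temperature nd α β γ x x'
  set w := pairWeight nd β γ x x'
  set g := targetGram nd α β γ x x'
  set D := (if IsDifficult nd x then c₁ r n nd α β γ else c₂ r n α β)
  set D' := (if IsDifficult nd x' then c₁ r n nd α β γ else c₂ r n α β)
  set C := c₂ r n α β
  calc -2 * (similarity nd α β γ x x' / S * (S / C ^ 2 * m / τ)) +
        D / S * (D' / S) * (S / C ^ 2 * m / τ) ^ 2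
      = -2 * ((similarity nd α β γ x x' / τ) * (S / S) * (m / C ^ 2)) +
        (D * D' / τ ^ 2) * (S / S) ^ 2 * (m / C ^ 2) ^ 2 := by ring
    _ = -2 * (w * g * (m / C ^ 2)) + C ^ 2 * w * (m / C ^ 2) ^ 2 := by
        rw [k1, k2, div_self hS.ne']; ring
    _ = _ := by field_simp; ring

end Loss

/-! ### A competitor that is exact between the classes -/

section Candidate
variable {r n k nd : ℕ} {α β γ : ℝ}

/-- The rank `k` is divided among the classes as evenly as possible; then the ranks lie all on the
same side of any threshold `e`. -/
theorem exists_balanced_ranks (hn : 1 ≤ n) (hk : r + 1 ≤ k) (e : ℕ) :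
    ∃ κ : Fin (r + 1) → ℕ, (∀ i, 1 ≤ κ i) ∧ (∀ i, κ i ≤ n) ∧
      ∑ i, κ i = min k ((r + 1) * n) ∧ ((∀ i, κ i ≤ e) ∨ ∀ i, e ≤ κ i) := by
  obtain ⟨K, hK⟩ : ∃ K, K = min k ((r + 1) * n) := ⟨_, rfl⟩
  have hdiv := Nat.div_add_mod K (r + 1)
  have hmod := Nat.mod_lt K (Nat.succ_pos r)
  have hK1 : r + 1 ≤ K := by
    rw [hK]; exact le_min hk (Nat.le_mul_of_pos_right _ hn)
  have hK2 : K ≤ (r + 1) * n := by rw [hK]; exact min_le_right _ _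
  have hq1 : 1 ≤ K / (r + 1) := (Nat.one_le_div_iff (Nat.succ_pos r)).mpr hK1
  have hq2 : K / (r + 1) ≤ n := Nat.div_le_of_le_mul hK2
  refine ⟨fun i => K / (r + 1) + if (i : ℕ) < K % (r + 1) then 1 else 0, ?_, ?_, ?_, ?_⟩
  · intro i; exact hq1.trans (Nat.le_add_right _ _)
  · intro i
    rcases hq2.lt_or_eq with h | h
    · simp only; split_ifs <;> omega
    · have : K % (r + 1) = 0 := by rw [h] at hdiv; omega
      simp [this, h]
  · rw [Finset.sum_add_distrib, Finset.sum_const, Finset.card_univ, Fintype.card_fin, smul_eq_mul,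
      Finset.sum_boole, Fin.card_filter_val_lt, min_eq_right hmod.le, ← hK]
    exact hdiv
  · rcases Nat.lt_or_ge (K / (r + 1)) e with h | h
    · left; intro i; simp only; split_ifs <;> omega
    · right; intro i; exact h.trans (Nat.le_add_right _ _)

open scoped MatrixOrder Matrix.Norms.L2Operator in
/-- A positive semidefinite matrix `A C Aᵀ` that factors through dimension at most `k` is the Gram
matrix of `k` features. -/
theorem exists_rank_le_factor {X ι : Type*} [Fintype X] [Fintype ι] [DecidableEq ι]
    (A : Matrix X ι ℝ) {C : Matrix ι ι ℝ} (hC : C.PosSemidef) (hk : Fintype.card ι ≤ k) :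
    ∃ F : Matrix X (Fin k) ℝ, F * Fᵀ = A * C * Aᵀ := by
  classical
  obtain ⟨B, hB⟩ : ∃ B : Matrix ι ι ℝ, C = Bᵀ * B := by
    obtain ⟨B, hB⟩ := CStarAlgebra.nonneg_iff_eq_star_mul_self.mp hC.nonneg
    exact ⟨B, hB⟩
  obtain ⟨g⟩ : Nonempty (ι ↪ Fin k) :=
    Function.Embedding.nonempty_of_card_le (by simpa using hk)
  refine ⟨Matrix.of fun x l => ∑ a, if g a = l then (A * Bᵀ) x a else 0, ?_⟩
  have e1 : A * C * Aᵀ = (A * Bᵀ) * (A * Bᵀ)ᵀ := by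
    rw [hB, transpose_mul, transpose_transpose]; simp only [Matrix.mul_assoc]
  rw [e1]
  ext x x'
  rw [Matrix.mul_apply, Matrix.mul_apply]
  symm
  refine Fintype.sum_of_injective g g.injective _ _ ?_ ?_
  · intro l hl
    have : ∀ a, g a ≠ l := fun a h => hl ⟨a, h⟩
    simp [this]
  · intro a
    simp

/-- The restriction of the vector `scaling` to the class `i`. -/
noncomputable def classVector (nd : ℕ) (α β γ : ℝ) (i : Fin (r + 1)) (x : Sample r n) : ℝ :=
  if x.1 = i then scaling nd α β γ x else 0

theorem targetGram_eq (nd : ℕ) (α β γ : ℝ) :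
    targetGram (r := r) (n := n) nd α β γ =
      Matrix.diagonal (fun x => (1 - α) * scaling nd α β γ x ^ 2) +
      ((α - β) • ∑ i, vecMulVec (classVector nd α β γ i) (classVector nd α β γ i) +
        β • vecMulVec (scaling nd α β γ) (scaling nd α β γ)) := by
  ext x x'
  simp only [targetGram, Matrix.of_apply, Matrix.add_apply, Matrix.smul_apply, Matrix.sum_apply,
    vecMulVec_apply, classVector, Matrix.diagonal_apply, ite_mul, zero_mul, mul_ite, mul_zero,
    smul_eq_mul, Finset.sum_ite_eq, Finset.mem_univ, if_true]
  by_cases h : x = x'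
  · subst h; simp; ring
  · by_cases h' : x.1 = x'.1
    · simp [h, h']; ring
    · simp [h, h']; ring

/-- Approximate factors of the diagonal part in each class, with the scaling vector in their column
spaces, combine to features whose Gram matrix equals the target between the classes. -/
theorem exists_block_gram (hβ : 0 ≤ β) (hαβ : β ≤ α)
    (κ : Fin (r + 1) → ℕ) (hκn : ∀ i, κ i ≤ n) (hκ : ∑ i, κ i ≤ k)
    (Z : Fin (r + 1) → Matrix (Fin n) (Fin n) ℝ) (q : Fin (r + 1) → Fin n → ℝ)
    (hZ0 : ∀ i, ∀ j l : Fin n, κ i ≤ (l : ℕ) → Z i j l = 0)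
    (hZq : ∀ i j, (Z i *ᵥ q i) j = scaling nd α β γ ((i, j) : Sample r n)) :
    ∃ F : Matrix (Sample r n) (Fin k) ℝ, gramError nd α β γ (F * Fᵀ) =
      ∑ i, ∑ j, ∑ j', ((if j = j' then (1 - α) * scaling nd α β γ ((i, j) : Sample r n) ^ 2 else 0)
        - (Z i * (Z i)ᵀ) j j') ^ 2 := by
  classical
  let ι := Σ i : Fin (r + 1), Fin (κ i)
  let A : Matrix (Sample r n) ι ℝ := Matrix.of fun x a =>
    if x.1 = a.1 then Z a.1 x.2 (Fin.castLE (hκn a.1) a.2) else 0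
  let Qa : ι → ℝ := fun a => q a.1 (Fin.castLE (hκn a.1) a.2)
  let Q : Fin (r + 1) → ι → ℝ := fun i a => if a.1 = i then Qa a else 0
  have hsum : ∀ i (g : Fin n → ℝ), (∀ l : Fin n, κ i ≤ (l : ℕ) → g l = 0) →
      ∑ l : Fin (κ i), g (Fin.castLE (hκn i) l) = ∑ l, g l := by
    intro i g hg
    refine Fintype.sum_of_injective (Fin.castLE (hκn i)) (Fin.castLE_injective _) _ _ ?_ ?_
    · intro l hl
      refine hg l ?_
      by_contra h
      exact hl ⟨⟨l, by omega⟩, rfl⟩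
    · intro l; rfl
  have hAQ : ∀ i, A *ᵥ Q i = classVector nd α β γ i := by
    intro i
    funext x
    obtain ⟨i', j⟩ := x
    have e1 : ∀ i'' : Fin (r + 1), ∑ l : Fin (κ i''), A (i', j) ⟨i'', l⟩ * Q i ⟨i'', l⟩ =
        if i' = i'' then (if i'' = i then scaling nd α β γ ((i', j) : Sample r n) else 0)
          else 0 := by
      intro i''
      simp only [A, Q, Qa, Matrix.of_apply]
      split_ifs with h1 h2
      · subst h1
        rw [← hZq, mulVec, dotProduct]
        exact hsum i' (fun l => Z i' j l * q i' l) fun l hl => by rw [hZ0 i' j l hl, zero_mul]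
      all_goals simp only [mul_zero, zero_mul, Finset.sum_const_zero]
    rw [mulVec, dotProduct, Fintype.sum_sigma]
    simp only [e1, classVector, Finset.sum_ite_eq, Finset.mem_univ, if_true]
  have hAQa : A *ᵥ Qa = scaling nd α β γ := by
    have e1 : Qa = ∑ i, Q i := by
      funext a; simp [Q]
    rw [e1, mulVec_sum]
    simp only [hAQ]
    funext x
    simp [classVector]
  have hAA : ∀ x x' : Sample r n, (A * Aᵀ) x x' =
      if x.1 = x'.1 then (Z x.1 * (Z x.1)ᵀ) x.2 x'.2 else 0 := by
    intro x x'
    rw [Matrix.mul_apply, Fintype.sum_sigma]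
    have e1 : ∀ i, ∑ l : Fin (κ i), A x ⟨i, l⟩ * Aᵀ ⟨i, l⟩ x' =
        if x.1 = i then (if x.1 = x'.1 then (Z x.1 * (Z x.1)ᵀ) x.2 x'.2 else 0) else 0 := by
      intro i
      simp only [A, transpose_apply, Matrix.of_apply]
      by_cases h1 : x.1 = i
      · subst h1
        by_cases h2 : x.1 = x'.1
        · simp only [if_pos h2, if_pos h2.symm, if_true]
          rw [Matrix.mul_apply]
          exact hsum x.1 (fun l => Z x.1 x.2 l * Z x.1 x'.2 l)
            fun l hl => by rw [hZ0 x.1 x.2 l hl, zero_mul]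
        · have h3 : ¬ x'.1 = x.1 := fun h => h2 h.symm
          simp [h2, h3]
      · simp [h1]
    simp only [e1, Finset.sum_ite_eq, Finset.mem_univ, if_true]
  let C : Matrix ι ι ℝ := 1 + ((α - β) • ∑ i, vecMulVec (Q i) (Q i) + β • vecMulVec Qa Qa)
  have hvv : ∀ v : ι → ℝ, (vecMulVec v v).PosSemidef := fun v => by
    simpa using posSemidef_vecMulVec_self_star v
  have hC : C.PosSemidef := PosSemidef.one.add
    (((posSemidef_sum _ fun i _ => hvv (Q i)).smul (sub_nonneg.mpr hαβ)).add ((hvv Qa).smul hβ))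
  obtain ⟨F, hF⟩ := exists_rank_le_factor (k := k) A hC (by simpa [ι] using hκ)
  have hvA : ∀ v : ι → ℝ, A * vecMulVec v v * Aᵀ = vecMulVec (A *ᵥ v) (A *ᵥ v) := fun v => by
    rw [mul_vecMulVec, vecMulVec_mul, vecMul_transpose]
  have hFG : F * Fᵀ = A * Aᵀ +
      ((α - β) • ∑ i, vecMulVec (classVector nd α β γ i) (classVector nd α β γ i) +
        β • vecMulVec (scaling nd α β γ) (scaling nd α β γ)) := by
    rw [hF]
    simp only [C, Matrix.mul_add, Matrix.add_mul, Matrix.mul_one, Matrix.mul_smul,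
      Matrix.smul_mul, Matrix.mul_sum, Matrix.sum_mul, hvA, hAQ, hAQa]
  refine ⟨F, ?_⟩
  -- outside the diagonal blocks the target is matched exactly
  have herr : ∀ x x', pairWeight nd β γ x x' * ((F * Fᵀ) x x' - targetGram nd α β γ x x') ^ 2 =
      if x.1 = x'.1 then ((if x.2 = x'.2 then (1 - α) * scaling nd α β γ x ^ 2 else 0)
        - (Z x.1 * (Z x.1)ᵀ) x.2 x'.2) ^ 2 else 0 := by
    intro x x'
    rw [hFG, targetGram_eq, Matrix.add_apply, Matrix.add_apply (Matrix.diagonal _), hAA,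
      Matrix.diagonal_apply]
    by_cases h : x.1 = x'.1
    · have hxx : x = x' ↔ x.2 = x'.2 := ⟨fun h' => h' ▸ rfl, fun h' => Prod.ext h h'⟩
      simp only [h, pairWeight, hxx, if_true]
      simp only [ne_eq, not_true, false_and, if_false]
      ring
    · have hxx : ¬ x = x' := fun h' => h (h' ▸ rfl)
      simp [h, hxx]
  rw [gramError]
  simp only [herr]
  rw [Fintype.sum_prod_type]
  refine Finset.sum_congr rfl fun i _ => Finset.sum_congr rfl fun j _ => ?_
  rw [Fintype.sum_prod_type]
  simp only [Finset.sum_ite_irrel, Finset.sum_const_zero, Finset.sum_ite_eq, Finset.mem_univ,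
    if_true]

end Candidate

/-! ### Minimizers nearly contain the class vectors -/

section Alignment
variable {r n k nd : ℕ} {α β γ : ℝ}

/-- The sum of the rank terms of the competitor is at most the rank term of the lower bound, since
the ranks `κ i` lie all on the same side of `n - nd`. -/
theorem sum_rank_deficit_le {κ : Fin (r + 1) → ℕ} (hnd : nd ≤ n)
    (hκ : ∑ i, κ i = min k ((r + 1) * n)) (hside : (∀ i, κ i ≤ n - nd) ∨ ∀ i, n - nd ≤ κ i)
    {T ε : ℝ} (hε0 : 0 ≤ ε) (hε1 : ε ≤ 1) (hT : ((r : ℝ) + 1) * n - k ≤ T) (hT0 : 0 ≤ T) :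
    ∑ i, (ε * ((n : ℝ) - κ i) + (1 - ε) * max 0 (((n : ℝ) - nd) - κ i)) ≤
      ε * T + (1 - ε) * max 0 (T - (r + 1) * nd) := by
  have hsum : ((r : ℝ) + 1) * n - ∑ i, (κ i : ℝ) ≤ T := by
    have h : (∑ i, (κ i : ℝ)) = min (k : ℝ) (((r : ℝ) + 1) * n) := by
      exact_mod_cast hκ
    rw [h]
    rcases min_choice (k : ℝ) (((r : ℝ) + 1) * n) with h | h <;> rw [h] <;> linarith
  have e1 : ∑ i, ((n : ℝ) - κ i) = ((r : ℝ) + 1) * n - ∑ i, (κ i : ℝ) := by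
    rw [Finset.sum_sub_distrib, Finset.sum_const, Finset.card_univ, Fintype.card_fin, nsmul_eq_mul]
    push_cast; ring
  rw [Finset.sum_add_distrib, ← Finset.mul_sum, ← Finset.mul_sum, e1]
  have h2 : ∑ i, max 0 (((n : ℝ) - nd) - κ i) ≤ max 0 (T - (r + 1) * nd) := by
    rcases hside with h | h
    · have e2 : ∀ i, max 0 (((n : ℝ) - nd) - κ i) = ((n : ℝ) - κ i) - nd := fun i => by
        have : (κ i : ℝ) ≤ n - nd := by
          rw [← Nat.cast_sub hnd]; exact_mod_cast h i
        rw [max_eq_right (by linarith)]; ring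
      simp only [e2]
      rw [Finset.sum_sub_distrib, e1, Finset.sum_const, Finset.card_univ, Fintype.card_fin,
        nsmul_eq_mul]
      refine le_max_of_le_right ?_
      push_cast; linarith
    · have e2 : ∀ i, max 0 (((n : ℝ) - nd) - κ i) = 0 := fun i => by
        have : (n : ℝ) - nd ≤ κ i := by
          rw [← Nat.cast_sub hnd]; exact_mod_cast h i
        exact max_eq_left (by linarith)
      simp only [e2, Finset.sum_const_zero]
      exact le_max_left _ _
  have : 0 ≤ 1 - ε := by linarith
  gcongr

theorem scaling_sq (h2 : 0 < c₂ r n α β) (h1 : 0 < c₁ r n nd α β γ) (x : Sample r n) :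
    scaling nd α β γ x ^ 2 =
      if IsDifficult nd x then c₂ r n α β / c₁ r n nd α β γ else 1 := by
  unfold scaling
  split_ifs
  · rw [div_pow, Real.sq_sqrt h2.le, Real.sq_sqrt h1.le]
  · norm_num

theorem trace_mul_self_le_gramError (hβ : 0 < β) (hβγ : β ≤ γ)
    {M : Matrix (Sample r n) (Sample r n) ℝ} (hM : Mᵀ = M) :
    ((M - targetGram nd α β γ) * (M - targetGram nd α β γ)).trace ≤ gramError nd α β γ M := by
  have hG : (targetGram (r := r) (n := n) nd α β γ)ᵀ = targetGram nd α β γ := by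
    ext x x'
    simp only [targetGram, transpose_apply, Matrix.of_apply, eq_comm (a := x') (b := x),
      eq_comm (a := x'.1) (b := x.1)]
    ring
  have hsym : (M - targetGram nd α β γ)ᵀ = M - targetGram nd α β γ := by
    rw [transpose_sub, hM, hG]
  rw [gramError, Matrix.trace]
  refine Finset.sum_le_sum fun x _ => ?_
  rw [Matrix.diag_apply, Matrix.mul_apply]
  refine Finset.sum_le_sum fun x' _ => ?_
  have e := congrFun₂ hsym x x'
  rw [transpose_apply] at e
  rw [e, ← sq, Matrix.sub_apply]
  have : 1 ≤ pairWeight nd β γ x x' := by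
    unfold pairWeight
    split_ifs
    · exact one_le_pow₀ ((one_le_div hβ).mpr hβγ)
    · exact le_rfl
  exact le_mul_of_one_le_left (sq_nonneg _) this

/-- The class vectors are close to the column space of the features of a minimizer: the rank terms
of the upper and the lower bound of the minimum cancel. -/
theorem exists_probe_near_classVector (hn : 1 ≤ n) (hnd : nd ≤ n) (hk : r + 1 ≤ k)
    (hβ : 0 < β) (hβγ : β < γ) (hγα : γ < α) (hα : α < 1)
    (F : Matrix (Sample r n) (Fin k) ℝ)
    (hF : ∀ F' : Matrix (Sample r n) (Fin k) ℝ,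
      gramError nd α β γ (F * Fᵀ) ≤ gramError nd α β γ (F' * F'ᵀ)) :
    ∃ b : Fin (r + 1) → Fin k → ℝ,
      ∑ i, ∑ x, (classVector nd α β γ i x - (F *ᵥ b i) x) ^ 2 ≤
        (r + 1) * (1 - α) * (1 - c₂ r n α β / c₁ r n nd α β γ) * nd /
          ((α - β) * ((n - nd) + nd * (c₂ r n α β / c₁ r n nd α β γ))) := by
  have hα0 : 0 < α := by linarith
  have h2 : 0 < c₂ r n α β := c₂_pos hn hβ hα0 hα
  have h21 : c₂ r n α β ≤ c₁ r n nd α β γ := c₂_le_c₁ hβγ.le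
  have h1 : 0 < c₁ r n nd α β γ := h2.trans_le h21
  obtain ⟨s, hs⟩ : ∃ s, s = √(c₂ r n α β) / √(c₁ r n nd α β γ) := ⟨_, rfl⟩
  have hs0 : 0 < s := by rw [hs]; exact div_pos (Real.sqrt_pos.mpr h2) (Real.sqrt_pos.mpr h1)
  have hs1 : s ≤ 1 := by
    rw [hs]; exact div_le_one_of_le₀ (Real.sqrt_le_sqrt h21) (Real.sqrt_nonneg _)
  have hss : c₂ r n α β / c₁ r n nd α β γ = s ^ 2 := by
    rw [hs, div_pow, Real.sq_sqrt h2.le, Real.sq_sqrt h1.le]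
  rw [hss]
  have hsc : ∀ x : Sample r n, scaling nd α β γ x = if IsDifficult nd x then s else 1 := fun x => by
    rw [scaling, hs]
  have hc : 0 < 1 - α := by linarith
  have hs21 : s ^ 2 ≤ 1 := pow_le_one₀ hs0.le hs1
  have hs41 : s ^ 4 ≤ 1 := pow_le_one₀ hs0.le hs1
  have hndn : (0 : ℝ) ≤ n - nd := by
    have : (nd : ℝ) ≤ n := by exact_mod_cast hnd
    linarith
  have hn0 : (0 : ℝ) < n := by exact_mod_cast hn
  have hpow : ∀ p : ℕ, ∑ j : Fin n, (if n ≤ (j : ℕ) + nd then s else 1) ^ p =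
      (n - nd) + nd * s ^ p := by
    intro p
    have : ∀ j : Fin n, (if n ≤ (j : ℕ) + nd then s else 1) ^ p =
        if n ≤ (j : ℕ) + nd then s ^ p else 1 := by
      intro j; split_ifs <;> simp
    simp only [this, sum_index_split hnd]
    ring
  -- a competitor built from the class structure
  obtain ⟨κ, hκ1, hκn, hκsum, hside⟩ := exists_balanced_ranks (k := k) hn hk (n - nd)
  choose Z q hZ0 hZq hZe using fun i => exists_class_factor (nd := nd) (hκ1 i) (hκn i) hc hs0 hs1
    (fun j : Fin n => if n ≤ (j : ℕ) + nd then s else 1) (fun j => rfl)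
  obtain ⟨F', hF'⟩ := exists_block_gram (k := k) (nd := nd) (γ := γ) hβ.le (by linarith : β ≤ α) κ
    hκn (hκsum.le.trans (min_le_left _ _)) Z q hZ0 (fun i j => by rw [hZq, hsc])
  have hup := hF F'
  rw [hF'] at hup
  simp only [hpow] at hZe
  set R : ℝ := ((n - nd) + nd * s ^ 4) / ((n - nd) + nd * s ^ 2) with hR
  have hup2 : gramError nd α β γ (F * Fᵀ) ≤ (1 - α) ^ 2 *
      (∑ i, (s ^ 4 * ((n : ℝ) - κ i) + (1 - s ^ 4) * max 0 (((n : ℝ) - nd) - κ i)) +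
        (r + 1) * (1 - R ^ 2)) := by
    refine hup.trans ?_
    calc _ ≤ ∑ i, (1 - α) ^ 2 * (s ^ 4 * ((n : ℝ) - κ i) +
          (1 - s ^ 4) * max 0 (((n : ℝ) - nd) - κ i) + (1 - R ^ 2)) := by
          refine Finset.sum_le_sum fun i _ => ?_
          simp only [hsc]
          exact hZe i
      _ = _ := by
          rw [← Finset.mul_sum, Finset.sum_add_distrib, Finset.sum_const, Finset.card_univ,
            Fintype.card_fin, nsmul_eq_mul]
          push_cast; ring
  -- the lower bound
  obtain ⟨Θ, hΘ, hΘ2, hΘF, hΘk, hΘ0, hΘb⟩ := exists_compl_projection F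
  choose b hb using fun i => hΘb (classVector nd α β γ i)
  refine ⟨b, ?_⟩
  have hres : ∀ i x, classVector nd α β γ i x - (F *ᵥ b i) x =
      (Θ *ᵥ classVector nd α β γ i) x := by
    intro i x; rw [← hb, Pi.sub_apply]; ring
  simp only [hres]
  set mis : ℝ := ∑ i, ∑ x, ((Θ *ᵥ classVector (r := r) (n := n) nd α β γ i) x) ^ 2 with hmis
  let E : Matrix (Sample r n) (Sample r n) ℝ :=
    Matrix.diagonal fun x => if IsDifficult nd x then 0 else 1
  have hEtr : E.trace = (r + 1) * (n - nd) := by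
    rw [Matrix.trace_diagonal, Fintype.sum_prod_type]
    simp only [IsDifficult, sum_index_split hnd, Finset.sum_const, Finset.card_univ,
      Fintype.card_fin, nsmul_eq_mul]
    push_cast; ring
  have hEpos : (1 - E).PosSemidef := by
    have : 1 - E = Matrix.diagonal fun x : Sample r n =>
        1 - if IsDifficult nd x then (0 : ℝ) else 1 := by
      rw [← Matrix.diagonal_one, Matrix.diagonal_sub]
    rw [this]
    refine PosSemidef.diagonal fun x => ?_
    simp only [Pi.zero_apply]
    split_ifs <;> norm_num
  have hG : targetGram (r := r) (n := n) nd α β γ =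
      (1 - α) • (s ^ 2 • (1 : Matrix (Sample r n) (Sample r n) ℝ) + (1 - s ^ 2) • E) +
      ((α - β) • ∑ i, vecMulVec (classVector nd α β γ i) (classVector nd α β γ i) +
        β • vecMulVec (scaling nd α β γ) (scaling nd α β γ)) := by
    rw [targetGram_eq]
    congr 1
    simp only [E, ← Matrix.diagonal_one, ← Matrix.diagonal_smul, Matrix.diagonal_add]
    congr 1
    funext x
    simp only [hsc, Pi.smul_apply, smul_eq_mul]
    split_ifs <;> ring
  have hM : (F * Fᵀ)ᵀ = F * Fᵀ := by simp [transpose_mul]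
  have hlow := approx_error_lower_bound hΘ hΘ2 hM
    (by rw [← Matrix.mul_assoc, hΘF, Matrix.zero_mul]) (by simp [E]) (by
      simp only [E, Matrix.diagonal_mul_diagonal]; congr 1; funext x; split_ifs <;> norm_num)
    hEpos hc.le (sq_nonneg s) hs21 (by linarith : 0 ≤ α - β) hβ.le (classVector nd α β γ)
    (scaling nd α β γ) hG
  have hle := hlow.trans ((trace_mul_self_le_gramError hβ hβγ.le hM).trans hup2)
  have hcard : (Fintype.card (Sample r n) : ℝ) = ((r : ℝ) + 1) * n := by
    rw [Fintype.card_prod, Fintype.card_fin, Fintype.card_fin]; push_cast; ring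
  rw [hcard] at hΘk hle
  have hdef := sum_rank_deficit_le (k := k) hnd hκsum hside (T := Θ.trace) (pow_nonneg hs0.le 4)
    hs41 hΘk hΘ0
  have e4 : (s ^ 2) ^ 2 = s ^ 4 := by ring
  have e5 : ((r : ℝ) + 1) * n - E.trace = (r + 1) * nd := by rw [hEtr]; ring
  rw [e4, e5] at hle
  have hc2 : 0 < (1 - α) ^ 2 := by positivity
  have hmain : 2 * (1 - α) * s ^ 2 * (α - β) * mis ≤ (1 - α) ^ 2 * ((r + 1) * (1 - R ^ 2)) := by
    have := mul_le_mul_of_nonneg_left hdef hc2.le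
    linarith
  have hD : 0 < ((n : ℝ) - nd) + nd * s ^ 2 := by
    have h3 : 0 < (n : ℝ) * s ^ 2 := by positivity
    have h4 : ((n : ℝ) - nd) * s ^ 2 ≤ (n - nd) := mul_le_of_le_one_right hndn hs21
    linarith
  have hRle : 1 - R ^ 2 ≤ 2 * (1 - R) := by linarith [sq_nonneg (1 - R)]
  have hR1 : 1 - R = s ^ 2 * ((1 - s ^ 2) * nd / ((n - nd) + nd * s ^ 2)) := by
    rw [hR]; field_simp; ring
  have hαβ : 0 < α - β := by linarith
  have hfin : (2 * (1 - α) * s ^ 2) * ((α - β) * mis) ≤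
      (2 * (1 - α) * s ^ 2) *
        ((r + 1) * (1 - α) * ((1 - s ^ 2) * nd / ((n - nd) + nd * s ^ 2))) := by
    calc _ = 2 * (1 - α) * s ^ 2 * (α - β) * mis := by ring
      _ ≤ (1 - α) ^ 2 * ((r + 1) * (1 - R ^ 2)) := hmain
      _ ≤ (1 - α) ^ 2 * ((r + 1) * (2 * (1 - R))) := by gcongr
      _ = _ := by rw [hR1]; ring
  have hfin2 := le_of_mul_le_mul_left hfin (by positivity)
  have e6 : ((r : ℝ) + 1) * (1 - α) * (1 - s ^ 2) * nd / ((α - β) * ((n - nd) + nd * s ^ 2)) =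
      (r + 1) * (1 - α) * ((1 - s ^ 2) * nd / ((n - nd) + nd * s ^ 2)) / (α - β) := by
    field_simp
  rw [e6, le_div_iff₀ hαβ]
  linarith

end Alignment

/-! ### Labels, augmentations and the cut of a classifier -/

section Probability
variable {d r n : ℕ} {P : Measure (EuclideanSpace ℝ (Fin d))}
  {A : Kernel (EuclideanSpace ℝ (Fin d)) (Sample r n)} {y : EuclideanSpace ℝ (Fin d) → Fin (r + 1)}

/-- The joint law of the label of a natural datum and of its augmentation. -/
noncomputable def jointLaw (P : Measure (EuclideanSpace ℝ (Fin d)))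
    (A : Kernel (EuclideanSpace ℝ (Fin d)) (Sample r n))
    (y : EuclideanSpace ℝ (Fin d) → Fin (r + 1)) (i : Fin (r + 1)) (x : Sample r n) : ℝ :=
  (P.compProd A).real {p | y p.1 = i ∧ p.2 = x}

theorem jointLaw_nonneg (i : Fin (r + 1)) (x : Sample r n) : 0 ≤ jointLaw P A y i x :=
  measureReal_nonneg

theorem measurable_real_singleton (x : Sample r n) : Measurable fun xbar => (A xbar).real {x} :=
  (Kernel.measurable_coe A (measurableSet_singleton x)).ennreal_toReal

variable [IsProbabilityMeasure P] [IsMarkovKernel A]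

theorem compProd_real_eq_integral {s : Set (EuclideanSpace ℝ (Fin d) × Sample r n)}
    (hs : MeasurableSet s) :
    (P.compProd A).real s = ∫ xbar, (A xbar).real (Prod.mk xbar ⁻¹' s) ∂P := by
  rw [measureReal_def, Measure.compProd_apply hs]
  simp only [measureReal_def]
  rw [integral_toReal]
  · exact (Kernel.measurable_kernel_prodMk_left hs).aemeasurable
  · exact Filter.Eventually.of_forall fun x => measure_lt_top _ _

theorem integrable_real_singleton_mul (x x' : Sample r n) :
    Integrable (fun xbar => (A xbar).real {x} * (A xbar).real {x'}) P := by
  refine Integrable.of_bound ((measurable_real_singleton x).mul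
    (measurable_real_singleton x')).aestronglyMeasurable 1 ?_
  refine Filter.Eventually.of_forall fun xbar => ?_
  rw [Real.norm_of_nonneg (mul_nonneg measureReal_nonneg measureReal_nonneg)]
  exact mul_le_one₀ measureReal_le_one measureReal_nonneg measureReal_le_one

theorem sum_real_singleton_eq (xbar : EuclideanSpace ℝ (Fin d)) (p : Sample r n → Prop)
    [DecidablePred p] :
    ∑ x, (if p x then (A xbar).real {x} else 0) = (A xbar).real {x | p x} := by
  rw [← Finset.sum_filter, sum_measureReal_singleton]
  congr 1
  ext x
  simp

theorem sum_real_singleton (xbar : EuclideanSpace ℝ (Fin d)) :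
    ∑ x, (A xbar).real {x} = 1 := by
  simpa only [if_true, Set.ofPred_true, probReal_univ] using
    sum_real_singleton_eq (A := A) xbar (fun _ => True)

/-- The probability of an event that depends only on the label and on the augmentation. -/
theorem compProd_real_eq_sum (hy : Measurable y) (R : Fin (r + 1) → Sample r n → Prop)
    [∀ i x, Decidable (R i x)] :
    (P.compProd A).real {p | R (y p.1) p.2} =
      ∑ i, ∑ x, if R i x then jointLaw P A y i x else 0 := by
  have hφ : Measurable fun p : EuclideanSpace ℝ (Fin d) × Sample r n => (y p.1, p.2) :=
    (hy.comp measurable_fst).prodMk measurable_snd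
  have h := sum_measureReal_preimage_singleton (μ := P.compProd A)
    (Finset.univ.filter fun z : Fin (r + 1) × Sample r n => R z.1 z.2)
    (f := fun p => (y p.1, p.2)) (fun z _ => hφ (measurableSet_singleton z))
  have e : (fun p : EuclideanSpace ℝ (Fin d) × Sample r n => (y p.1, p.2)) ⁻¹'
      (Finset.univ.filter fun z : Fin (r + 1) × Sample r n => R z.1 z.2 : Finset _) =
      {p | R (y p.1) p.2} := by
    ext p; simp
  rw [e] at h
  rw [← h, Finset.sum_filter, Fintype.sum_prod_type]
  refine Finset.sum_congr rfl fun i _ => Finset.sum_congr rfl fun x _ => ?_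
  have e2 : (fun p : EuclideanSpace ℝ (Fin d) × Sample r n => (y p.1, p.2)) ⁻¹' {(i, x)} =
      {p | y p.1 = i ∧ p.2 = x} := by
    ext p; simp [Prod.ext_iff]
  rw [e2, jointLaw]

theorem sum_jointLaw_label (hy : Measurable y) (i : Fin (r + 1)) :
    ∑ x, jointLaw P A y i x = P.real {xbar | y xbar = i} := by
  classical
  have h := compProd_real_eq_sum (P := P) (A := A) hy (fun i' _ => i' = i)
  simp only [Finset.sum_ite_irrel, Finset.sum_const_zero, Finset.sum_ite_eq', Finset.mem_univ,
    if_true] at h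
  rw [← h]
  have e : {p : EuclideanSpace ℝ (Fin d) × Sample r n | y p.1 = i} =
      Prod.fst ⁻¹' {xbar | y xbar = i} := rfl
  have hm : MeasurableSet {xbar | y xbar = i} := hy (measurableSet_singleton i)
  rw [e, measureReal_def, ← Measure.fst_apply hm, Measure.fst_compProd]
  rfl

theorem sum_jointLaw_sample (hy : Measurable y) (x : Sample r n) :
    ∑ i, jointLaw P A y i x = vertexWeight P A x := by
  classical
  have h := compProd_real_eq_sum (P := P) (A := A) hy (fun _ x' => x' = x)
  simp only [Finset.sum_ite_eq', Finset.mem_univ, if_true] at h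
  rw [← h]
  have e : {p : EuclideanSpace ℝ (Fin d) × Sample r n | p.2 = x} = Prod.snd ⁻¹' {x} := rfl
  rw [e, compProd_real_eq_integral (measurable_snd (measurableSet_singleton x)), vertexWeight]
  simp only [edgeWeight]
  rw [← integral_finsetSum _ fun x' _ => integrable_real_singleton_mul x x']
  refine integral_congr_ae (Filter.Eventually.of_forall fun xbar => ?_)
  simp only
  rw [← Finset.mul_sum, sum_real_singleton, mul_one]
  rfl

/-- Two augmentations of one datum are rarely given different labels by a classifier that mostly
recovers the label of the datum. -/
theorem cut_le_two_mul_error (hy : Measurable y) (g : Sample r n → Fin (r + 1)) :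
    ∑ x, ∑ x', (if g x ≠ g x' then edgeWeight P A x x' else 0) ≤
      2 * (P.compProd A).real {p | g p.2 ≠ y p.1} := by
  have hmeas : MeasurableSet {p : EuclideanSpace ℝ (Fin d) × Sample r n | g p.2 ≠ y p.1} := by
    have h1 : Measurable fun p : EuclideanSpace ℝ (Fin d) × Sample r n => g p.2 :=
      (measurable_of_finite g).comp measurable_snd
    exact (measurableSet_eq_fun h1 (hy.comp measurable_fst)).compl
  rw [compProd_real_eq_integral hmeas, ← integral_const_mul]
  have e1 : ∑ x, ∑ x', (if g x ≠ g x' then edgeWeight P A x x' else 0) =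
      ∫ xbar, ∑ x, ∑ x', (if g x ≠ g x' then (A xbar).real {x} * (A xbar).real {x'} else 0) ∂P := by
    have hint : ∀ x x', Integrable (fun xbar =>
        if g x ≠ g x' then (A xbar).real {x} * (A xbar).real {x'} else 0) P := by
      intro x x'
      by_cases h : g x ≠ g x'
      · simpa only [if_pos h] using integrable_real_singleton_mul x x'
      · simp only [if_neg h]; exact integrable_zero _ _ _
    rw [integral_finsetSum _ fun x _ => integrable_finsetSum _ fun x' _ => hint x x']
    refine Finset.sum_congr rfl fun x _ => ?_
    rw [integral_finsetSum _ fun x' _ => hint x x']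
    refine Finset.sum_congr rfl fun x' _ => ?_
    by_cases h : g x ≠ g x'
    · simp only [if_pos h, edgeWeight]
    · simp only [if_neg h, integral_zero]
  rw [e1]
  have hint2 : Integrable (fun xbar => ∑ x, ∑ x',
      (if g x ≠ g x' then (A xbar).real {x} * (A xbar).real {x'} else 0)) P := by
    refine integrable_finsetSum _ fun x _ => integrable_finsetSum _ fun x' _ => ?_
    by_cases h : g x ≠ g x'
    · simpa only [if_pos h] using integrable_real_singleton_mul x x'
    · simp only [if_neg h]; exact integrable_zero _ _ _
  have hint3 : Integrable (fun xbar => 2 * (A xbar).real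
      (Prod.mk xbar ⁻¹' {p : EuclideanSpace ℝ (Fin d) × Sample r n | g p.2 ≠ y p.1})) P := by
    refine Integrable.const_mul ?_ 2
    refine Integrable.of_bound
      (Kernel.measurable_kernel_prodMk_left hmeas).ennreal_toReal.aestronglyMeasurable 1 ?_
    refine Filter.Eventually.of_forall fun xbar => ?_
    exact (Real.norm_of_nonneg measureReal_nonneg).trans_le (measureReal_le_one (μ := A xbar))
  refine integral_mono hint2 hint3 fun xbar => ?_
  simp only
  have e2 : (A xbar).real (Prod.mk xbar ⁻¹'
      {p : EuclideanSpace ℝ (Fin d) × Sample r n | g p.2 ≠ y p.1}) =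
      ∑ x, (if g x ≠ y xbar then (A xbar).real {x} else 0) := by
    rw [sum_real_singleton_eq]; rfl
  have hnn : ∀ x, 0 ≤ (A xbar).real {x} := fun x => measureReal_nonneg
  have h1 := sum_real_singleton (A := A) xbar
  rw [e2]
  obtain ⟨a, ha⟩ : ∃ a : Sample r n → ℝ, ∀ x, (A xbar).real {x} = a x := ⟨_, fun _ => rfl⟩
  simp only [ha] at hnn h1 ⊢
  have h2 : ∀ x x', (if g x ≠ g x' then a x * a x' else 0) ≤
      (if g x ≠ y xbar then a x else 0) * a x' + a x * (if g x' ≠ y xbar then a x' else 0) := by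
    intro x x'
    have h3 := mul_nonneg (hnn x) (hnn x')
    by_cases e : g x = y xbar <;> by_cases e' : g x' = y xbar
    · simp [e, e']
    · simp only [e, ne_eq, not_true_eq_false, if_false, e', not_false_eq_true, if_true, zero_mul,
        zero_add]
      split_ifs <;> linarith
    · simp [e, e']
    · simp only [ne_eq, e, e', not_false_eq_true, if_true]
      split_ifs <;> linarith
  refine (Finset.sum_le_sum fun x _ => Finset.sum_le_sum fun x' _ => h2 x x').trans_eq ?_
  simp only [Finset.sum_add_distrib, ← Finset.mul_sum, ← Finset.sum_mul, h1]
  ring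

end Probability

/-! ### Confusion matrices and Birkhoff's theorem -/

section Birkhoff
variable {ι : Type*} [Fintype ι] [DecidableEq ι]

/-- By Birkhoff's theorem, the sum of the squares of the entries of a doubly stochastic matrix is
an average of its sums along permutations. -/
theorem exists_perm_sum_sq_le {M : Matrix ι ι ℝ} (hM : M ∈ doublyStochastic ℝ ι) :
    ∃ π : Equiv.Perm ι, ∑ i, ∑ j, M i j ^ 2 ≤ ∑ i, M i (π i) := by
  obtain ⟨θ, hθ0, hθ1, hθ⟩ := exists_eq_sum_perm_of_mem_doublyStochastic hM
  have h1 : ∑ i, ∑ j, M i j ^ 2 = ∑ π, θ π * ∑ i, M i (π i) := by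
    have h2 : ∀ i j, M i j ^ 2 = ∑ π : Equiv.Perm ι, θ π * (if π i = j then M i j else 0) := by
      intro i j
      have h3 : M i j = ∑ π : Equiv.Perm ι, θ π * (if π i = j then 1 else 0) := by
        conv_lhs => rw [← hθ]
        simp [Matrix.sum_apply, Equiv.Perm.permMatrix, PEquiv.toMatrix_apply, eq_comm]
      rw [sq]
      nth_rewrite 1 [h3]
      rw [Finset.sum_mul]
      exact Finset.sum_congr rfl fun π _ => by rw [mul_assoc, ite_mul, one_mul, zero_mul]
    calc ∑ i, ∑ j, M i j ^ 2
        = ∑ i, ∑ j, ∑ π : Equiv.Perm ι, θ π * (if π i = j then M i j else 0) := by simp only [h2]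
      _ = ∑ i, ∑ π : Equiv.Perm ι, ∑ j, θ π * (if π i = j then M i j else 0) :=
          Finset.sum_congr rfl fun i _ => Finset.sum_comm
      _ = ∑ i, ∑ π : Equiv.Perm ι, θ π * M i (π i) := by
          simp only [← Finset.mul_sum, Finset.sum_ite_eq, Finset.mem_univ, if_true]
      _ = _ := by rw [Finset.sum_comm]; simp only [Finset.mul_sum]
  by_contra! hlt
  have h4 : ∑ π, θ π * ∑ i, M i (π i) < ∑ i, ∑ j, M i j ^ 2 := by
    obtain ⟨π, hπ⟩ : ∃ π, 0 < θ π := by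
      by_contra! h
      have := Finset.sum_nonpos fun π (_ : π ∈ Finset.univ) => h π
      linarith
    calc ∑ π, θ π * ∑ i, M i (π i) < ∑ π, θ π * ∑ i, ∑ j, M i j ^ 2 :=
          Finset.sum_lt_sum (fun π _ => mul_le_mul_of_nonneg_left (hlt π).le (hθ0 π))
            ⟨π, Finset.mem_univ _, mul_lt_mul_of_pos_left (hlt π) hπ⟩
      _ = _ := by rw [← Finset.sum_mul, hθ1, one_mul]
  exact absurd h1 h4.ne'

end Birkhoff

section Labels
variable {ι X : Type*} [DecidableEq ι] [Fintype X] {c g : X → ι} {w : X → ℝ} {R : ℝ}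

/-- The mass `w` of the elements of class `i` that the classifier `g` labels `j`. -/
noncomputable def confusion (c g : X → ι) (w : X → ℝ) (i j : ι) : ℝ :=
  ∑ x, if c x = i ∧ g x = j then w x else 0

theorem confusion_nonneg (hw : ∀ x, 0 ≤ w x) (i j : ι) : 0 ≤ confusion c g w i j :=
  Finset.sum_nonneg fun x _ => by split_ifs; exacts [hw x, le_rfl]

variable [Fintype ι]

theorem sum_confusion (i : ι) : ∑ j, confusion c g w i j = ∑ x, if c x = i then w x else 0 := by
  simp only [confusion]
  rw [Finset.sum_comm]
  refine Finset.sum_congr rfl fun x _ => ?_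
  by_cases h : c x = i <;> simp [h]

theorem sum_class_eq_one (hR : 0 < R) (hι : (Fintype.card ι : ℝ) = R)
    (hcls : ∀ i, ∑ x, (if c x = i then w x else 0) = 1 / R) : ∑ x, w x = 1 := by
  have h : ∑ i, ∑ x, (if c x = i then w x else 0) = ∑ x, w x := by
    rw [Finset.sum_comm]; simp
  rw [← h]
  simp only [hcls, Finset.sum_const, Finset.card_univ, nsmul_eq_mul, hι]
  field_simp

theorem confusion_le (hw : ∀ x, 0 ≤ w x) (hcls : ∀ i, ∑ x, (if c x = i then w x else 0) = 1 / R)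
    (i j : ι) : confusion c g w i j ≤ 1 / R := by
  rw [← hcls i, ← sum_confusion (g := g)]
  exact Finset.single_le_sum (fun j _ => confusion_nonneg hw i j) (Finset.mem_univ j)

theorem sum_confusion_sq_le (hR : 0 < R) (hι : (Fintype.card ι : ℝ) = R) (hw : ∀ x, 0 ≤ w x)
    (hcls : ∀ i, ∑ x, (if c x = i then w x else 0) = 1 / R) :
    ∑ i, ∑ j, confusion c g w i j ^ 2 ≤ 1 / R := by
  calc ∑ i, ∑ j, confusion c g w i j ^ 2 ≤ ∑ i, ∑ j, confusion c g w i j * (1 / R) := by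
        refine Finset.sum_le_sum fun i _ => Finset.sum_le_sum fun j _ => ?_
        rw [sq]
        exact mul_le_mul_of_nonneg_left (confusion_le hw hcls i j) (confusion_nonneg hw i j)
    _ = 1 / R := by
        simp only [← Finset.sum_mul, sum_confusion, hcls, Finset.sum_const, Finset.card_univ,
          nsmul_eq_mul, hι]
        field_simp

theorem le_sum_confusion_sq (hR : 0 < R) (hι : (Fintype.card ι : ℝ) = R)
    (hcls : ∀ i, ∑ x, (if c x = i then w x else 0) = 1 / R) :
    1 / R ^ 2 ≤ ∑ i, ∑ j, confusion c g w i j ^ 2 := by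
  have h : ∀ i, (1 / R) ^ 2 / R ≤ ∑ j, confusion c g w i j ^ 2 := by
    intro i
    have h1 := sq_sum_le_card_mul_sum_sq (s := Finset.univ) (f := fun j => confusion c g w i j)
    rw [sum_confusion, hcls, Finset.card_univ, hι] at h1
    rw [div_le_iff₀ hR]; linarith
  have h2 := Finset.sum_le_sum fun i (_ : i ∈ Finset.univ) => h i
  rw [Finset.sum_const, Finset.card_univ, nsmul_eq_mul, hι] at h2
  calc 1 / R ^ 2 = R * ((1 / R) ^ 2 / R) := by field_simp
    _ ≤ _ := h2

theorem sum_mul_same {κ : Type*} [Fintype κ] [DecidableEq κ] (h : X → κ) :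
    ∑ x, ∑ x', (if h x = h x' then w x * w x' else 0) =
      ∑ j, (∑ x, if h x = j then w x else 0) ^ 2 := by
  simp only [sq, Finset.sum_mul_sum]
  rw [Finset.sum_comm' (t' := Finset.univ) (s' := fun _ => Finset.univ) (by simp)]
  refine (Finset.sum_congr rfl fun x _ => ?_).trans Finset.sum_comm
  rw [Finset.sum_comm]
  refine Finset.sum_congr rfl fun x' _ => ?_
  by_cases e : h x = h x'
  · simp [e, mul_comm]
  · simp [e, Ne.symm e, ite_mul, mul_ite]

/-- The weight of the cut of a classifier in a graph whose edge weights are proportional to the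
vertex weights, with a factor `s` within the classes and a factor `t` between them. -/
theorem sum_cut_eq (hR : 0 < R) (hι : (Fintype.card ι : ℝ) = R)
    (hcls : ∀ i, ∑ x, (if c x = i then w x else 0) = 1 / R) (s t : ℝ) :
    ∑ x, ∑ x', (if g x ≠ g x' then w x * w x' * (if c x = c x' then s else t) else 0) =
      t * (1 - ∑ j, (∑ x, if g x = j then w x else 0) ^ 2) +
        (s - t) * (1 / R - ∑ i, ∑ j, confusion c g w i j ^ 2) := by
  have h1 := sum_class_eq_one hR hι hcls
  have e1 : ∑ x, ∑ x', w x * w x' = 1 := by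
    rw [← Finset.sum_mul_sum, h1, one_mul]
  have e2 : ∑ x, ∑ x', (if c x = c x' then w x * w x' else 0) = 1 / R := by
    rw [sum_mul_same]
    simp only [hcls, Finset.sum_const, Finset.card_univ, nsmul_eq_mul, hι]
    field_simp
  have e3 := sum_mul_same (w := w) g
  have e4 : ∑ x, ∑ x', (if (c x, g x) = (c x', g x') then w x * w x' else 0) =
      ∑ i, ∑ j, confusion c g w i j ^ 2 := by
    rw [sum_mul_same (fun x => (c x, g x)), Fintype.sum_prod_type]
    simp only [confusion, Prod.mk.injEq]
  rw [← e2, ← e3, ← e4, ← e1]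
  simp only [← Finset.sum_sub_distrib, Finset.mul_sum, ← Finset.sum_add_distrib]
  refine Finset.sum_congr rfl fun x _ => Finset.sum_congr rfl fun x' _ => ?_
  by_cases hc : c x = c x' <;> by_cases hg : g x = g x' <;> simp [hc, hg] <;> ring

variable {J : ι → X → ℝ}

/-- The labels given by `g` are almost balanced, with a deviation that is quadratic in the error.
-/
theorem sum_label_mass_sq_le (hR : 0 < R) (hι : (Fintype.card ι : ℝ) = R)
    (hJ : ∀ i x, 0 ≤ J i x) (hrow : ∀ i, ∑ x, J i x = 1 / R) :
    ∑ j, (∑ x, if g x = j then ∑ i, J i x else 0) ^ 2 ≤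
      1 / R + 2 * (∑ i, ∑ x, if g x ≠ i then J i x else 0) ^ 2 := by
  obtain ⟨ε, hε⟩ : ∃ ε, ε = ∑ i, ∑ x, if g x ≠ i then J i x else 0 := ⟨_, rfl⟩
  obtain ⟨p, hp⟩ : ∃ p : ι → ℝ, ∀ j, p j = ∑ x, ∑ i, if g x = j ∧ i ≠ j then J i x else 0 :=
    ⟨_, fun _ => rfl⟩
  obtain ⟨q, hq⟩ : ∃ q : ι → ℝ, ∀ j, q j = ∑ x, if g x ≠ j then J j x else 0 := ⟨_, fun _ => rfl⟩
  have hp0 : ∀ j, 0 ≤ p j := fun j => by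
    rw [hp]
    exact Finset.sum_nonneg fun x _ => Finset.sum_nonneg fun i _ => by
      split_ifs; exacts [hJ i x, le_rfl]
  have hq0 : ∀ j, 0 ≤ q j := fun j => by
    rw [hq]
    exact Finset.sum_nonneg fun x _ => by split_ifs; exacts [hJ j x, le_rfl]
  have hqs : ∑ j, q j = ε := by simp only [hq, hε]
  have hps : ∑ j, p j = ε := by
    simp only [hp, hε]
    rw [Finset.sum_comm, Finset.sum_comm (s := Finset.univ (α := ι))]
    refine Finset.sum_congr rfl fun x _ => ?_
    rw [Finset.sum_comm]
    refine Finset.sum_congr rfl fun i _ => ?_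
    by_cases h : g x = i
    · simp only [h, ne_eq, not_true_eq_false, if_false]
      exact Finset.sum_eq_zero fun j _ => if_neg fun h2 => h2.2 h2.1
    · rw [Finset.sum_eq_single (g x)]
      · simp [h, Ne.symm h]
      · intro j _ hj; simp [Ne.symm hj]
      · simp
  have hm : ∀ j, (∑ x, if g x = j then ∑ i, J i x else 0) = 1 / R + (p j - q j) := by
    intro j
    rw [← hrow j, hp, hq, ← Finset.sum_sub_distrib, ← Finset.sum_add_distrib]
    refine Finset.sum_congr rfl fun x _ => ?_
    by_cases h : g x = j
    · simp only [h, true_and, if_true, ne_eq, not_true_eq_false, if_false, sub_zero]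
      rw [← Finset.add_sum_erase _ _ (Finset.mem_univ j), ← Finset.sum_filter]
      congr 1
      refine Finset.sum_congr ?_ fun _ _ => rfl
      ext i; simp
    · simp [h]
  have hsq : ∀ u : ι → ℝ, (∀ j, 0 ≤ u j) → ∑ j, u j = ε → ∑ j, u j ^ 2 ≤ ε ^ 2 := by
    intro u hu hus
    calc ∑ j, u j ^ 2 ≤ ∑ j, u j * ε := by
          refine Finset.sum_le_sum fun j _ => ?_
          rw [sq]
          refine mul_le_mul_of_nonneg_left ?_ (hu j)
          rw [← hus]
          exact Finset.single_le_sum (fun j _ => hu j) (Finset.mem_univ j)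
      _ = ε ^ 2 := by rw [← Finset.sum_mul, hus, sq]
  simp only [hm]
  rw [← hε]
  calc ∑ j, (1 / R + (p j - q j)) ^ 2
      ≤ ∑ j, ((1 / R) ^ 2 + 2 / R * (p j - q j) + (p j ^ 2 + q j ^ 2)) := by
        refine Finset.sum_le_sum fun j _ => ?_
        have := mul_nonneg (hp0 j) (hq0 j)
        have e : (1 / R + (p j - q j)) ^ 2 = (1 / R) ^ 2 + 2 / R * (p j - q j) +
          (p j ^ 2 + q j ^ 2) - 2 * (p j * q j) := by ring
        linarith
    _ = 1 / R + (∑ j, p j ^ 2 + ∑ j, q j ^ 2) := by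
        simp only [Finset.sum_add_distrib, ← Finset.mul_sum, Finset.sum_sub_distrib, hps, hqs,
          Finset.sum_const, Finset.card_univ, nsmul_eq_mul, hι]
        field_simp
        ring
    _ ≤ _ := by linarith [hsq p hp0 hps, hsq q hq0 hqs]

/-- Labels that are recoverable from the samples agree, up to a permutation, with the classes of
the samples, as far as the confusion matrix of the classifier allows. -/
theorem exists_perm_label_error_le (hR : 0 < R) (hι : (Fintype.card ι : ℝ) = R)
    (hJ : ∀ i x, 0 ≤ J i x) (hrow : ∀ i, ∑ x, J i x = 1 / R)
    (hcls : ∀ i, ∑ x, (if c x = i then ∑ i', J i' x else 0) = 1 / R) :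
    ∃ π : Equiv.Perm ι, (∑ i, ∑ x, if π (c x) ≠ i then J i x else 0) ≤
      1 - R * (∑ i, ∑ j, confusion c g (fun x => ∑ i', J i' x) i j ^ 2) +
        2 * ∑ i, ∑ x, if g x ≠ i then J i x else 0 := by
  obtain ⟨D, hD⟩ : ∃ D, D = confusion c g (fun x => ∑ i', J i' x) := ⟨_, rfl⟩
  obtain ⟨N, hN⟩ : ∃ N : Matrix ι ι ℝ, ∀ i j, N i j = ∑ x, if c x = i then J j x else 0 :=
    ⟨fun i j => ∑ x, if c x = i then J j x else 0, fun _ _ => rfl⟩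
  have hw : ∀ x, 0 ≤ ∑ i', J i' x := fun x => Finset.sum_nonneg fun i _ => hJ i x
  have hNrow : ∀ i, ∑ j, N i j = 1 / R := by
    intro i
    rw [← hcls i]
    simp only [hN]
    rw [Finset.sum_comm]
    refine Finset.sum_congr rfl fun x _ => ?_
    split_ifs <;> simp
  have hNcol : ∀ j, ∑ i, N i j = 1 / R := by
    intro j
    rw [← hrow j]
    simp only [hN]
    rw [Finset.sum_comm]
    simp
  have hN0 : ∀ i j, 0 ≤ N i j := fun i j => by
    rw [hN]
    exact Finset.sum_nonneg fun x _ => by split_ifs; exacts [hJ j x, le_rfl]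
  obtain ⟨π, hπ⟩ := exists_perm_sum_sq_le (M := R • N) (by
    rw [mem_doublyStochastic_iff_sum]
    simp only [Matrix.smul_apply, smul_eq_mul, ← Finset.mul_sum, hNrow, hNcol]
    refine ⟨fun i j => mul_nonneg hR.le (hN0 i j), fun _ => ?_, fun _ => ?_⟩ <;> field_simp)
  simp only [Matrix.smul_apply, smul_eq_mul, mul_pow, ← Finset.mul_sum] at hπ
  have hπ' : R * ∑ i, ∑ j, N i j ^ 2 ≤ ∑ i, N i (π i) := by
    refine le_of_mul_le_mul_left ?_ hR
    linarith
  obtain ⟨E, hE⟩ : ∃ E : ι → ι → ℝ, ∀ i j, E i j =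
      ∑ x, ∑ i', if c x = i ∧ g x = j ∧ i' ≠ j then J i' x else 0 := ⟨_, fun _ _ => rfl⟩
  have hE0 : ∀ i j, 0 ≤ E i j := fun i j => by
    rw [hE]
    exact Finset.sum_nonneg fun x _ => Finset.sum_nonneg fun i' _ => by
      split_ifs; exacts [hJ i' x, le_rfl]
  have hEs : ∑ i, ∑ j, E i j = ∑ i, ∑ x, if g x ≠ i then J i x else 0 := by
    have e : ∀ i', ∀ x, (if g x ≠ i' then J i' x else 0) =
        ∑ i, ∑ j, if c x = i ∧ g x = j ∧ i' ≠ j then J i' x else 0 := by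
      intro i' x
      rw [Finset.sum_eq_single (c x), Finset.sum_eq_single (g x)]
      · simp [eq_comm]
      · intro j _ hj; simp [Ne.symm hj]
      · simp
      · intro i _ hi; simp [Ne.symm hi]
      · simp
    simp only [e, hE]
    calc ∑ i, ∑ j, ∑ x, ∑ i', (if c x = i ∧ g x = j ∧ i' ≠ j then J i' x else 0)
        = ∑ i, ∑ x, ∑ j, ∑ i', (if c x = i ∧ g x = j ∧ i' ≠ j then J i' x else 0) :=
          Finset.sum_congr rfl fun i _ => Finset.sum_comm
      _ = ∑ x, ∑ i, ∑ j, ∑ i', (if c x = i ∧ g x = j ∧ i' ≠ j then J i' x else 0) :=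
          Finset.sum_comm
      _ = ∑ x, ∑ i, ∑ i', ∑ j, (if c x = i ∧ g x = j ∧ i' ≠ j then J i' x else 0) :=
          Finset.sum_congr rfl fun x _ => Finset.sum_congr rfl fun i _ => Finset.sum_comm
      _ = ∑ x, ∑ i', ∑ i, ∑ j, (if c x = i ∧ g x = j ∧ i' ≠ j then J i' x else 0) :=
          Finset.sum_congr rfl fun x _ => Finset.sum_comm
      _ = _ := Finset.sum_comm
  have hDN : ∀ i j, D i j ≤ N i j + E i j := by
    intro i j
    rw [hD, confusion, hN, hE, ← Finset.sum_add_distrib]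
    refine Finset.sum_le_sum fun x _ => ?_
    by_cases h1 : c x = i
    · by_cases h2 : g x = j
      · simp only [h1, h2, and_self, if_true, true_and]
        rw [← Finset.add_sum_erase _ _ (Finset.mem_univ j), ← Finset.sum_filter]
        refine (congrArg _ (Finset.sum_congr ?_ fun _ _ => rfl)).le
        ext i'; simp
      · simp [h1, h2, hJ]
    · simp [h1]
  have hD0 : ∀ i j, 0 ≤ D i j := fun i j => hD ▸ confusion_nonneg hw i j
  have hD1 : ∀ i j, R * D i j ≤ 1 := fun i j => by
    have := confusion_le (g := g) hw hcls i j
    rw [← hD, le_div_iff₀ hR] at this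
    linarith
  have hkey : R * ∑ i, ∑ j, D i j ^ 2 - 2 * ∑ i, ∑ j, E i j ≤ R * ∑ i, ∑ j, N i j ^ 2 := by
    simp only [Finset.mul_sum, ← Finset.sum_sub_distrib]
    refine Finset.sum_le_sum fun i _ => Finset.sum_le_sum fun j _ => ?_
    -- `N² ≥ 2DN - D²` and `D (D - N) ≤ D E ≤ E / R`
    have h1 : 0 ≤ R * (N i j - D i j) ^ 2 := by positivity
    have h2 := mul_le_mul_of_nonneg_left (hDN i j) (mul_nonneg hR.le (hD0 i j))
    have h3 := mul_le_mul_of_nonneg_right (hD1 i j) (hE0 i j)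
    linear_combination h1 + 2 * h2 + 2 * h3
  have htot : ∑ i, ∑ x, J i x = 1 := by
    simp only [hrow, Finset.sum_const, Finset.card_univ, nsmul_eq_mul, hι]
    field_simp
  have hfin : (∑ i, ∑ x, if π (c x) ≠ i then J i x else 0) = 1 - ∑ i, N i (π i) := by
    rw [← htot, ← Equiv.sum_comp π (fun i => ∑ x, J i x),
      ← Equiv.sum_comp π (fun i => ∑ x, if π (c x) ≠ i then J i x else 0),
      ← Finset.sum_sub_distrib]
    refine Finset.sum_congr rfl fun i _ => ?_
    rw [hN, ← Finset.sum_sub_distrib]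
    refine Finset.sum_congr rfl fun x _ => ?_
    by_cases h : c x = i <;> simp [h]
  refine ⟨π, ?_⟩
  rw [← hD, hfin]
  linarith

end Labels

/-! ### The cut and the misassigned samples -/

section Probing
variable {d r n k nd : ℕ} {α β γ : ℝ}

/-- The similarity of distinct samples is bounded below by the product of their degrees, with a
better factor inside a class. -/
theorem similarity_ge_degree_mul_degree (hnd : nd ≤ n) (hα : α < 1) (hβ : 0 < β)
    (hβγ : β < γ) (hγα : γ < α) (h2 : 0 < c₂ r n α β) {x x' : Sample r n} (hx : x ≠ x') :
    (if IsDifficult nd x then c₁ r n nd α β γ else c₂ r n α β) *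
      (if IsDifficult nd x' then c₁ r n nd α β γ else c₂ r n α β) *
      (if x.1 = x'.1 then α / (c₁ r n nd α β γ / c₂ r n α β) ^ 2
        else β / (c₁ r n nd α β γ / c₂ r n α β)) ≤
      c₂ r n α β ^ 2 * similarity nd α β γ x x' := by
  have h12 : c₂ r n α β ≤ c₁ r n nd α β γ := c₂_le_c₁ hβγ.le
  have hγ : 0 < γ := hβ.trans hβγ
  have hα0 : 0 < α := hγ.trans hγα
  -- a difficult sample is at most `γ / β` times as similar to the others as an easy one
  have h1 : β * c₁ r n nd α β γ ≤ γ * c₂ r n α β := by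
    have h3 : (nd : ℝ) * r * β ≤ c₂ r n α β := by
      have h4 : (nd : ℝ) ≤ n := by exact_mod_cast hnd
      have h5 : (nd : ℝ) * (r * β) ≤ n * (r * β) := mul_le_mul_of_nonneg_right h4 (by positivity)
      have h6 : 0 ≤ (n : ℝ) * α := by positivity
      unfold c₂; linarith
    have h7 : c₁ r n nd α β γ = c₂ r n α β + nd * r * (γ - β) := rfl
    have h8 := mul_le_mul_of_nonneg_left h3 (sub_nonneg.mpr hβγ.le)
    rw [h7]; linarith
  obtain ⟨C, hC⟩ : ∃ C, C = c₁ r n nd α β γ := ⟨_, rfl⟩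
  obtain ⟨c, hc⟩ : ∃ c, c = c₂ r n α β := ⟨_, rfl⟩
  rw [← hC, ← hc] at h1 h12 ⊢
  rw [← hc] at h2
  have hC0 : 0 < C := h2.trans_le h12
  have hcc : c * c ≤ c * C := mul_le_mul_of_nonneg_left h12 h2.le
  have hcC : c * C ≤ C * C := mul_le_mul_of_nonneg_right h12 hC0.le
  have eα : α / (C / c) ^ 2 = α * c ^ 2 / C ^ 2 := by field_simp
  have eβ : β / (C / c) = β * c / C := by field_simp
  unfold similarity
  rw [if_neg hx, eα, eβ]
  by_cases hcl : x.1 = x'.1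
  · simp only [hcl, if_true]
    rw [mul_div_assoc', div_le_iff₀ (by positivity)]
    have h3 : 0 ≤ α * c ^ 2 := by positivity
    split_ifs
    · linarith
    · linarith [mul_le_mul_of_nonneg_right hcC h3]
    · linarith [mul_le_mul_of_nonneg_right hcC h3]
    · linarith [mul_le_mul_of_nonneg_right (hcc.trans hcC) h3]
  · simp only [hcl, if_false]
    rw [mul_div_assoc', div_le_iff₀ hC0]
    by_cases hx1 : IsDifficult nd x <;> by_cases hx2 : IsDifficult nd x' <;>
      simp only [hx1, hx2, if_true, if_false, and_true, and_false, and_self]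
    · have h3 : 0 ≤ c * C := by positivity
      linarith [mul_le_mul_of_nonneg_right h1 h3]
    · linarith
    · linarith
    · linarith [mul_le_mul_of_nonneg_left h12 (by positivity : 0 ≤ c ^ 2 * β)]

/-- The cut of the classifier `g` has weight at most `2 δ`; bounding the edge weights from below by
products of vertex weights expresses this through the impurity of the confusion matrix of `g`. -/
theorem cut_inequality {P : Measure (EuclideanSpace ℝ (Fin d))} [IsProbabilityMeasure P]
    {A : Kernel (EuclideanSpace ℝ (Fin d)) (Sample r n)} [IsMarkovKernel A]
    {y : EuclideanSpace ℝ (Fin d) → Fin (r + 1)} (hr : 1 ≤ r) (hn : 1 ≤ n) (hnd : nd ≤ n)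
    (hβ : 0 < β) (hβγ : β < γ) (hγα : γ < α) (hα : α < 1) (hy : Measurable y)
    (hbal : ∀ i, P.real {xbar | y xbar = i} = 1 / ((r : ℝ) + 1))
    (hw : ∀ x x', edgeWeight P A x x' = similarity nd α β γ x x' /
      ∑ u : Sample r n, ∑ v : Sample r n, similarity nd α β γ u v)
    (hcls : ∀ i, ∑ x, (if x.1 = i then vertexWeight P A x else 0) = 1 / ((r : ℝ) + 1))
    (g : Sample r n → Fin (r + 1)) {δ : ℝ} (hδ : (P.compProd A).real {p | g p.2 ≠ y p.1} ≤ δ) :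
    n * r * β / c₂ r n α β / (c₁ r n nd α β γ / c₂ r n α β) * (1 - (2 * δ) ^ 2) +
      (n * α / c₂ r n α β / (c₁ r n nd α β γ / c₂ r n α β) ^ 2 -
        n * r * β / c₂ r n α β / r / (c₁ r n nd α β γ / c₂ r n α β)) *
      (1 - (r + 1) * ∑ i, ∑ j, confusion Prod.fst g (vertexWeight P A) i j ^ 2) ≤ 2 * δ := by
  have hα0 : 0 < α := hβ.trans (hβγ.trans hγα)
  have h2 : 0 < c₂ r n α β := c₂_pos hn hβ hα0 hα
  have h12 : c₂ r n α β ≤ c₁ r n nd α β γ := c₂_le_c₁ hβγ.le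
  have h1 := h2.trans_le h12
  have hR : (0 : ℝ) < r + 1 := by positivity
  have hr' : (1 : ℝ) ≤ r := by exact_mod_cast hr
  have hn' : (1 : ℝ) ≤ n := by exact_mod_cast hn
  have hι : (Fintype.card (Fin (r + 1)) : ℝ) = r + 1 := by simp
  obtain ⟨S, hS⟩ : ∃ S, S = ∑ u : Sample r n, ∑ v : Sample r n, similarity nd α β γ u v := ⟨_, rfl⟩
  rw [← hS] at hw
  have hSge : ((r : ℝ) + 1) * n * c₂ r n α β ≤ S := by
    rw [hS, sum_sum_similarity hnd, mul_assoc]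
    refine mul_le_mul_of_nonneg_left ?_ hR.le
    have := mul_le_mul_of_nonneg_left h12 (Nat.cast_nonneg (α := ℝ) nd)
    linarith
  have hS0 : 0 < S := lt_of_lt_of_le (by positivity) hSge
  have hcut := (cut_le_two_mul_error (P := P) (A := A) hy g)
  obtain ⟨ε, hε⟩ : ∃ ε, ε = (P.compProd A).real {p | g p.2 ≠ y p.1} := ⟨_, rfl⟩
  have hε' : ε = ∑ i, ∑ x, if g x ≠ i then jointLaw P A y i x else 0 := by
    rw [hε, compProd_real_eq_sum hy (fun i x => g x ≠ i)]
  rw [← hε] at hcut hδ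
  have hε0 : 0 ≤ ε := hε ▸ measureReal_nonneg
  obtain ⟨σ, hσ⟩ : ∃ σ, σ = c₁ r n nd α β γ / c₂ r n α β := ⟨_, rfl⟩
  have hσ0 : 0 < σ := hσ ▸ div_pos h1 h2
  obtain ⟨m, hm⟩ : ∃ m, m = ∑ j, (∑ x, if g x = j then vertexWeight P A x else 0) ^ 2 :=
    ⟨_, rfl⟩
  have hmle : m ≤ 1 / ((r : ℝ) + 1) + 2 * ε ^ 2 := by
    have := sum_label_mass_sq_le (g := g) hR hι (J := jointLaw P A y)
      (fun i x => jointLaw_nonneg i x) (fun i => by rw [sum_jointLaw_label hy, hbal])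
    simp only [sum_jointLaw_sample hy] at this
    rwa [← hε', ← hm] at this
  have hedge : ∀ x x', ((r : ℝ) + 1) * n / c₂ r n α β *
      (if g x ≠ g x' then vertexWeight P A x * vertexWeight P A x' *
        (if x.1 = x'.1 then α / σ ^ 2 else β / σ) else 0) ≤
      if g x ≠ g x' then edgeWeight P A x x' else 0 := by
    intro x x'
    by_cases hg : g x ≠ g x'
    · have hx : x ≠ x' := fun e => hg (by rw [e])
      have h := similarity_ge_degree_mul_degree hnd hα hβ hβγ hγα h2 hx
      rw [if_pos hg, if_pos hg, vertexWeight_eq hnd hw, vertexWeight_eq hnd hw, hw]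
      rw [← hσ] at h
      have hsim : 0 ≤ similarity nd α β γ x x' := by
        have := hβ.trans hβγ
        unfold similarity
        split_ifs <;> linarith
      obtain ⟨D, hD⟩ : ∃ D, D = if IsDifficult nd x then c₁ r n nd α β γ else c₂ r n α β :=
        ⟨_, rfl⟩
      obtain ⟨D', hD'⟩ : ∃ D, D = if IsDifficult nd x' then c₁ r n nd α β γ else c₂ r n α β :=
        ⟨_, rfl⟩
      obtain ⟨v, hv⟩ : ∃ v, v = if x.1 = x'.1 then α / σ ^ 2 else β / σ := ⟨_, rfl⟩
      rw [← hD, ← hD', ← hv] at h ⊢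
      calc ((r : ℝ) + 1) * n / c₂ r n α β * (D / S * (D' / S) * v)
          = ((r : ℝ) + 1) * n / (c₂ r n α β * S ^ 2) * (D * D' * v) := by field_simp
        _ ≤ ((r : ℝ) + 1) * n / (c₂ r n α β * S ^ 2) *
            (c₂ r n α β ^ 2 * similarity nd α β γ x x') :=
            mul_le_mul_of_nonneg_left h (by positivity)
        _ = ((r : ℝ) + 1) * n * c₂ r n α β * (similarity nd α β γ x x' / S ^ 2) := by field_simp
        _ ≤ S * (similarity nd α β γ x x' / S ^ 2) :=
            mul_le_mul_of_nonneg_right hSge (by positivity)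
        _ = _ := by field_simp
    · rw [if_neg hg, if_neg hg, mul_zero]
  have hsum := (Finset.sum_le_sum fun x (_ : x ∈ Finset.univ) =>
    Finset.sum_le_sum fun x' (_ : x' ∈ Finset.univ) => hedge x x').trans hcut
  simp only [← Finset.mul_sum] at hsum
  rw [sum_cut_eq (c := Prod.fst) hR hι hcls, ← hm] at hsum
  obtain ⟨q, hq⟩ : ∃ q, q = ∑ i, ∑ j, confusion Prod.fst g (vertexWeight P A) i j ^ 2 := ⟨_, rfl⟩
  rw [← hq] at hsum ⊢
  rw [← hσ]
  have hm2 : (r : ℝ) * (1 - (2 * δ) ^ 2) ≤ (r + 1) * (1 - m) := by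
    have h3 : ((r : ℝ) + 1) * m ≤ 1 + 2 * (r + 1) * ε ^ 2 := by
      have := mul_le_mul_of_nonneg_left hmle hR.le
      have e : ((r : ℝ) + 1) * (1 / (r + 1) + 2 * ε ^ 2) = 1 + 2 * (r + 1) * ε ^ 2 := by
        field_simp
      linarith
    have h4 : ε ^ 2 ≤ δ ^ 2 := pow_le_pow_left₀ hε0 hδ 2
    have h5 := mul_le_mul_of_nonneg_right hr' (sq_nonneg ε)
    have h6 := mul_le_mul_of_nonneg_left h4 (by positivity : (0 : ℝ) ≤ 4 * r)
    linarith
  have hcoef : 0 ≤ n * β / c₂ r n α β / σ := by positivity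
  have hfin := mul_le_mul_of_nonneg_left hm2 hcoef
  have hr0 : (r : ℝ) ≠ 0 := by positivity
  calc _ = n * β / c₂ r n α β / σ * (r * (1 - (2 * δ) ^ 2)) +
        (n * α / c₂ r n α β / σ ^ 2 - n * β / c₂ r n α β / σ) * (1 - (r + 1) * q) := by
        field_simp
    _ ≤ n * β / c₂ r n α β / σ * ((r + 1) * (1 - m)) +
        (n * α / c₂ r n α β / σ ^ 2 - n * β / c₂ r n α β / σ) * (1 - (r + 1) * q) := by
        linarith
    _ = ((r : ℝ) + 1) * n / c₂ r n α β * (β / σ * (1 - m) +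
        (α / σ ^ 2 - β / σ) * (1 / (r + 1) - q)) := by
        field_simp
    _ ≤ 2 * ε := hsum
    _ ≤ 2 * δ := by linarith

/-- A sample that the probes do not assign to its class contributes to their approximation
error. -/
theorem half_sq_le_sum_sq {ι : Type*} [Fintype ι] [DecidableEq ι] {i i' : ι} (hi : i' ≠ i)
    {t : ℝ} (ht : 0 ≤ t) {v : ι → ℝ} (hv : v i ≤ v i') :
    t ^ 2 / 2 ≤ ∑ j, ((if i = j then t else 0) - v j) ^ 2 := by
  have h1 : ((if i = i then t else 0) - v i) ^ 2 + ((if i = i' then t else 0) - v i') ^ 2 ≤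
      ∑ j, ((if i = j then t else 0) - v j) ^ 2 := by
    rw [← Finset.sum_pair (f := fun j => ((if i = j then t else 0) - v j) ^ 2) hi.symm]
    exact Finset.sum_le_sum_of_subset_of_nonneg (Finset.subset_univ _) fun _ _ _ => sq_nonneg _
  rw [if_pos rfl, if_neg hi.symm] at h1
  refine le_trans ?_ h1
  rcases le_total 0 (v i) with h | h
  · have := pow_le_pow_left₀ h hv 2
    linarith [sq_nonneg (t - 2 * v i)]
  · linarith [mul_nonneg ht (neg_nonneg.mpr h), sq_nonneg (v i), sq_nonneg (v i'), sq_nonneg t]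

/-- The weight of the samples whose own class does not have the strictly largest score, when the
scores `v i` approximate the class vectors. -/
theorem sum_misassigned_weight_le {P : Measure (EuclideanSpace ℝ (Fin d))}
    {A : Kernel (EuclideanSpace ℝ (Fin d)) (Sample r n)} (hn : 1 ≤ n) (hnd : nd ≤ n)
    (hβ : 0 < β) (hβγ : β < γ) (hγα : γ < α) (hα : α < 1)
    (hw : ∀ x x', edgeWeight P A x x' = similarity nd α β γ x x' /
      ∑ u : Sample r n, ∑ v : Sample r n, similarity nd α β γ u v)
    {v : Fin (r + 1) → Sample r n → ℝ}
    (hv : ∑ i, ∑ x, (classVector nd α β γ i x - v i x) ^ 2 ≤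
        (r + 1) * (1 - α) * (1 - c₂ r n α β / c₁ r n nd α β γ) * nd /
          ((α - β) * ((n - nd) + nd * (c₂ r n α β / c₁ r n nd α β γ))))
    (p : Sample r n → Prop) [DecidablePred p] (hp : ∀ x, p x → ∃ i ≠ x.1, v x.1 x ≤ v i x) :
    ∑ x, (if p x then vertexWeight P A x else 0) ≤
      2 * (c₁ r n nd α β γ / c₂ r n α β) * (c₁ r n nd α β γ / c₂ r n α β - 1) * (1 - α) * nd /
        ((α - β) * n ^ 2) := by
  have hα0 : 0 < α := hβ.trans (hβγ.trans hγα)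
  have h2 : 0 < c₂ r n α β := c₂_pos hn hβ hα0 hα
  have h12 : c₂ r n α β ≤ c₁ r n nd α β γ := c₂_le_c₁ hβγ.le
  have h1 := h2.trans_le h12
  have hn' : (0 : ℝ) < n := by exact_mod_cast hn
  have hnd' : (nd : ℝ) ≤ n := by exact_mod_cast hnd
  rw [sum_sum_similarity hnd] at hw
  obtain ⟨σ, hσ⟩ : ∃ σ, σ = c₁ r n nd α β γ / c₂ r n α β := ⟨_, rfl⟩
  have hσ0 : 0 < σ := hσ ▸ div_pos h1 h2
  have hσ1 : 1 ≤ σ := by rw [hσ, le_div_iff₀ h2]; linarith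
  have hσi : c₂ r n α β / c₁ r n nd α β γ = 1 / σ := by rw [hσ, one_div_div]
  have hc1 : c₁ r n nd α β γ = c₂ r n α β * σ := by rw [hσ]; field_simp
  obtain ⟨e, he⟩ : ∃ e : ℝ, e = n - nd := ⟨_, rfl⟩
  have he0 : 0 ≤ e := by linarith
  have hnd0 : (0 : ℝ) ≤ nd := by positivity
  have hX : 0 < e + σ * nd := by
    have := mul_le_mul_of_nonneg_right hσ1 hnd0
    linarith
  have hY : 0 < e + nd * (1 / σ) := by
    rw [show e + nd * (1 / σ) = (e * σ + nd) / σ by field_simp]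
    have := mul_le_mul_of_nonneg_left hσ1 he0
    exact div_pos (by linarith) hσ0
  obtain ⟨S, hS⟩ : ∃ S, S = ((r : ℝ) + 1) * (c₂ r n α β * (e + σ * nd)) := ⟨_, rfl⟩
  have hS0 : 0 < S := by rw [hS]; positivity
  have hSe : ((r : ℝ) + 1) * ((n - nd) * c₂ r n α β + nd * c₁ r n nd α β γ) = S := by
    rw [hS, hc1, he]; ring
  rw [hSe] at hw
  have hpt : ∀ x, (if p x then vertexWeight P A x else 0) ≤
      2 * c₂ r n α β * σ ^ 2 / S * ∑ i, (classVector nd α β γ i x - v i x) ^ 2 := by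
    intro x
    by_cases hx : p x
    · obtain ⟨i, hi, hvi⟩ := hp x hx
      have hs := scaling_sq (nd := nd) (γ := γ) h2 h1 x
      have hs0 : 0 ≤ scaling nd α β γ x := by
        unfold scaling; split_ifs <;> positivity
      have h3 := half_sq_le_sum_sq hi hs0 (v := fun j => v j x) hvi
      have h4 : vertexWeight P A x ≤ c₂ r n α β * σ ^ 2 / S * scaling nd α β γ x ^ 2 := by
        rw [vertexWeight_eq hnd hw, hs, hσi, hc1]
        split_ifs
        · exact le_of_eq (by field_simp)
        · rw [mul_one]
          refine div_le_div_of_nonneg_right ?_ hS0.le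
          exact le_mul_of_one_le_right h2.le (one_le_pow₀ hσ1)
      rw [if_pos hx]
      refine h4.trans ?_
      calc c₂ r n α β * σ ^ 2 / S * scaling nd α β γ x ^ 2
          = 2 * c₂ r n α β * σ ^ 2 / S * (scaling nd α β γ x ^ 2 / 2) := by ring
        _ ≤ _ := mul_le_mul_of_nonneg_left h3 (by positivity)
    · rw [if_neg hx]
      positivity
  refine (Finset.sum_le_sum fun x _ => hpt x).trans ?_
  rw [← Finset.mul_sum, Finset.sum_comm]
  refine (mul_le_mul_of_nonneg_left hv (by positivity)).trans ?_
  rw [← hσ, hσi, ← he, hS]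
  have hαβ : 0 < α - β := by linarith
  have hXY : (n : ℝ) ^ 2 ≤ (e + σ * nd) * (e + nd * (1 / σ)) := by
    have e1 : (e + σ * nd) * (e + nd * (1 / σ)) = (e + nd) ^ 2 + e * nd * (σ - 1) ^ 2 / σ := by
      field_simp; ring
    have e2 : (n : ℝ) = e + nd := by rw [he]; ring
    rw [e1, e2]
    have : 0 ≤ e * nd * (σ - 1) ^ 2 / σ := by positivity
    linarith
  calc 2 * c₂ r n α β * σ ^ 2 / (((r : ℝ) + 1) * (c₂ r n α β * (e + σ * nd))) *
        ((r + 1) * (1 - α) * (1 - 1 / σ) * nd / ((α - β) * (e + nd * (1 / σ))))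
      = 2 * σ * (σ - 1) * (1 - α) * nd /
        ((α - β) * ((e + σ * nd) * (e + nd * (1 / σ)))) := by
        obtain ⟨Y, hYe⟩ : ∃ Y, Y = e + nd * (1 / σ) := ⟨_, rfl⟩
        rw [← hYe] at hY ⊢
        field_simp
    _ ≤ _ := by
        refine div_le_div_of_nonneg_left ?_ (by positivity)
          (mul_le_mul_of_nonneg_left hXY hαβ.le)
        have : 0 ≤ σ - 1 := by linarith
        have : 0 ≤ 1 - α := by linarith
        positivity

end Probing

/-! ### The linear probing error of a minimizer -/

section Final
variable {d r n k nd : ℕ} {α β γ : ℝ} {P : Measure (EuclideanSpace ℝ (Fin d))}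
  {A : Kernel (EuclideanSpace ℝ (Fin d)) (Sample r n)}
  {y : EuclideanSpace ℝ (Fin d) → Fin (r + 1)} {f : Sample r n → Fin k → ℝ}

theorem linearProbingError_le (B : Matrix (Fin (r + 1)) (Fin k) ℝ) :
    linearProbingError P A y f ≤ (P.compProd A).real {p | ¬ Predicts B (f p.2) (y p.1)} :=
  ciInf_le ⟨0, by rintro _ ⟨B, rfl⟩; exact measureReal_nonneg⟩ B

/-- Rescaling turns a minimizer of the loss into a best approximation of the normalized
similarity matrix. -/
theorem exists_gramError_minimizer (hnd : nd ≤ n) {S : ℝ} (hS : 0 < S)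
    (hw : ∀ x x', edgeWeight P A x x' = similarity nd α β γ x x' / S)
    (hβ : 0 < β) (hγ : 0 < γ) (h2 : 0 < c₂ r n α β) (h1 : 0 < c₁ r n nd α β γ)
    (hf : ∀ f' : Sample r n → Fin k → ℝ,
      tempLoss P A (temperature nd α β γ) f ≤ tempLoss P A (temperature nd α β γ) f') :
    ∃ F : Matrix (Sample r n) (Fin k) ℝ, (∀ x l, f x l = √S / c₂ r n α β * F x l) ∧
      ∀ F' : Matrix (Sample r n) (Fin k) ℝ,
        gramError nd α β γ (F * Fᵀ) ≤ gramError nd α β γ (F' * F'ᵀ) := by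
  have hs : 0 < √S := Real.sqrt_pos.mpr hS
  have hfF : ∀ x l, f x l = √S / c₂ r n α β * (c₂ r n α β / √S * f x l) := fun x l => by
    field_simp
  refine ⟨fun x l => c₂ r n α β / √S * f x l, hfF, fun F' => ?_⟩
  have h := hf fun x l => √S / c₂ r n α β * F' x l
  have e : f = fun x l => √S / c₂ r n α β * (c₂ r n α β / √S * f x l) :=
    funext fun x => funext fun l => hfF x l
  have e2 := tempLoss_eq hnd hS hw hβ hγ h2 h1 fun x l => c₂ r n α β / √S * f x l
  rw [← e] at e2
  rw [e2, tempLoss_eq hnd hS hw hβ hγ h2 h1 F', div_le_div_iff_of_pos_right (by positivity)] at h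
  exact sub_le_sub_iff_right _ |>.mp h

/-- With a single class, every probe predicts the only label. -/
theorem linearProbingError_eq_zero_of_single_class
    {A : Kernel (EuclideanSpace ℝ (Fin d)) (Sample 0 n)}
    {y : EuclideanSpace ℝ (Fin d) → Fin (0 + 1)} {f : Sample 0 n → Fin k → ℝ} :
    linearProbingError P A y f = 0 := by
  have h : ∀ B : Matrix (Fin (0 + 1)) (Fin k) ℝ,
      {q : EuclideanSpace ℝ (Fin d) × Sample 0 n | ¬ Predicts B (f q.2) (y q.1)} = ∅ := by
    intro B
    ext q
    simp only [Set.mem_ofPred_eq, Set.mem_empty_iff_false, iff_false, not_not]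
    exact fun j hj => absurd (Subsingleton.elim (α := Fin 1) _ _) hj
  simp only [linearProbingError, h, measureReal_empty, ciInf_const]

theorem sum_sum_similarity_pos (hn : 1 ≤ n) (hnd : nd ≤ n) (hβ : 0 < β) (hβγ : β < γ)
    (hγα : γ < α) (hα : α < 1) :
    0 < ∑ u : Sample r n, ∑ v : Sample r n, similarity nd α β γ u v := by
  have h2 : 0 < c₂ r n α β := c₂_pos hn hβ (hβ.trans (hβγ.trans hγα)) hα
  have h12 : c₂ r n α β ≤ c₁ r n nd α β γ := c₂_le_c₁ hβγ.le
  have hn' : (0 : ℝ) < n := by exact_mod_cast hn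
  rw [sum_sum_similarity hnd]
  have h3 : 0 < n * c₂ r n α β := by positivity
  have h4 := mul_le_mul_of_nonneg_left h12 (Nat.cast_nonneg (α := ℝ) nd)
  exact mul_pos (by positivity) (by linarith)

theorem sum_class_vertexWeight (hn : 1 ≤ n) (hnd : nd ≤ n) (hβ : 0 < β) (hβγ : β < γ)
    (hγα : γ < α) (hα : α < 1)
    (hw : ∀ x x', edgeWeight P A x x' = similarity nd α β γ x x' /
      ∑ u : Sample r n, ∑ v : Sample r n, similarity nd α β γ u v) (i : Fin (r + 1)) :
    ∑ x, (if x.1 = i then vertexWeight P A x else 0) = 1 / ((r : ℝ) + 1) := by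
  have hS := sum_sum_similarity_pos (r := r) hn hnd hβ hβγ hγα hα
  simp only [vertexWeight_eq hnd hw]
  rw [sum_sum_similarity hnd] at hS ⊢
  rw [Fintype.sum_prod_type, Finset.sum_comm]
  simp only [Finset.sum_ite_eq', Finset.mem_univ, if_true, ← Finset.sum_div]
  rw [sum_index_split hnd]
  have := (pos_of_mul_pos_right hS (by positivity)).ne'
  field_simp

variable [IsProbabilityMeasure P] [IsMarkovKernel A]

/-- The probes of the classes, relabelled by `π`, fail only where the label is not `π` of the class
or where a probe of another class has a score at least as large. -/
theorem linearProbingError_le_of_probes (hy : Measurable y) {F : Matrix (Sample r n) (Fin k) ℝ}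
    {s : ℝ} (hs : 0 < s) (hF : ∀ x l, f x l = s * F x l) (b : Fin (r + 1) → Fin k → ℝ)
    (π : Equiv.Perm (Fin (r + 1))) (p : Sample r n → Prop) [DecidablePred p]
    (hp : ∀ x, ¬ p x → ∀ i ≠ x.1, (F *ᵥ b i) x < (F *ᵥ b x.1) x) :
    linearProbingError P A y f ≤
      (∑ i, ∑ x, if π x.1 ≠ i then jointLaw P A y i x else 0) +
        ∑ x, if p x then vertexWeight P A x else 0 := by
  classical
  obtain ⟨B, hB⟩ : ∃ B : Matrix (Fin (r + 1)) (Fin k) ℝ, B = Matrix.of fun j => b (π.symm j) :=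
    ⟨_, rfl⟩
  have hscore : ∀ x j, (B *ᵥ f x) j = s * (F *ᵥ b (π.symm j)) x := by
    intro x j
    simp only [hB, mulVec, dotProduct, Matrix.of_apply, hF, Finset.mul_sum]
    exact Finset.sum_congr rfl fun l _ => by ring
  refine (linearProbingError_le B).trans ?_
  rw [compProd_real_eq_sum hy fun i x => ¬ Predicts B (f x) i]
  have e : ∑ x, (if p x then vertexWeight P A x else 0) =
      ∑ i, ∑ x, if p x then jointLaw P A y i x else 0 := by
    rw [Finset.sum_comm]
    refine Finset.sum_congr rfl fun x _ => ?_
    rw [← sum_jointLaw_sample hy]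
    split_ifs <;> simp
  rw [e]
  simp only [← Finset.sum_add_distrib]
  refine Finset.sum_le_sum fun i _ => Finset.sum_le_sum fun x _ => ?_
  have h0 := jointLaw_nonneg (P := P) (A := A) (y := y) i x
  by_cases hπ : π x.1 = i
  · by_cases hpx : p x
    · simp only [hπ, hpx, ne_eq, not_true_eq_false, if_false, if_true, zero_add]
      split_ifs <;> linarith
    · have hpred : Predicts B (f x) i := by
        intro j hj
        rw [hscore, hscore]
        refine mul_lt_mul_of_pos_left ?_ hs
        rw [← hπ, Equiv.symm_apply_apply]
        refine hp x hpx _ fun h => hj ?_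
        rw [← hπ, ← h, Equiv.apply_symm_apply]
      simp [hpred, hπ, hpx]
  · simp only [ne_eq, hπ, not_false_eq_true, if_true]
    split_ifs <;> linarith

/-- The linear probing error of a minimizer is at most the disagreement between the labels and the
classes of the samples, plus the weight of the samples that the probes assign to a wrong class. -/
theorem linearProbingError_le_of_minimizer (hn : 1 ≤ n) (hnd : nd ≤ n) (hk : r + 1 ≤ k)
    (hβ : 0 < β) (hβγ : β < γ) (hγα : γ < α) (hα : α < 1) (hy : Measurable y)
    (hbal : ∀ i, P.real {xbar | y xbar = i} = 1 / ((r : ℝ) + 1))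
    (hw : ∀ x x', edgeWeight P A x x' = similarity nd α β γ x x' /
      ∑ u : Sample r n, ∑ v : Sample r n, similarity nd α β γ u v)
    (hf : ∀ f' : Sample r n → Fin k → ℝ,
      tempLoss P A (temperature nd α β γ) f ≤ tempLoss P A (temperature nd α β γ) f')
    (g : Sample r n → Fin (r + 1)) :
    linearProbingError P A y f ≤
      1 - (r + 1) * ∑ i, ∑ j, confusion Prod.fst g (vertexWeight P A) i j ^ 2 +
        2 * (P.compProd A).real {p | g p.2 ≠ y p.1} +
        2 * (c₁ r n nd α β γ / c₂ r n α β) * (c₁ r n nd α β γ / c₂ r n α β - 1) * (1 - α) * nd /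
          ((α - β) * n ^ 2) := by
  classical
  have hγ : 0 < γ := hβ.trans hβγ
  have h2 : 0 < c₂ r n α β := c₂_pos hn hβ (hγ.trans hγα) hα
  have h1 : 0 < c₁ r n nd α β γ := h2.trans_le (c₂_le_c₁ hβγ.le)
  have hS := sum_sum_similarity_pos (r := r) hn hnd hβ hβγ hγα hα
  have hcls := sum_class_vertexWeight hn hnd hβ hβγ hγα hα hw
  obtain ⟨π, hπ⟩ := exists_perm_label_error_le (c := Prod.fst) (g := g) (R := (r : ℝ) + 1)
    (by positivity) (by simp) (J := jointLaw P A y) (fun i x => jointLaw_nonneg i x)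
    (fun i => by rw [sum_jointLaw_label hy, hbal])
    (by simpa only [sum_jointLaw_sample hy] using hcls)
  simp only [sum_jointLaw_sample hy] at hπ
  rw [← compProd_real_eq_sum hy (fun i x => g x ≠ i)] at hπ
  obtain ⟨F, hfF, hF⟩ := exists_gramError_minimizer hnd hS hw hβ hγ h2 h1 hf
  obtain ⟨b, hb⟩ := exists_probe_near_classVector hn hnd hk hβ hβγ hγα hα F hF
  have hmis := sum_misassigned_weight_le hn hnd hβ hβγ hγα hα hw (v := fun i => F *ᵥ b i) hb
    (fun x => ∃ i ≠ x.1, (F *ᵥ b x.1) x ≤ (F *ᵥ b i) x) fun x hx => hx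
  have herr := linearProbingError_le_of_probes hy (div_pos (Real.sqrt_pos.mpr hS) h2) hfF b π
    (fun x => ∃ i ≠ x.1, (F *ᵥ b x.1) x ≤ (F *ᵥ b i) x) (P := P) (A := A) fun x hx => by
      push Not at hx
      exact hx
  linarith

end Final

end TempScaling

open TempScaling

theorem theorem3 (d r n nd k : ℕ) (α β γ δ : ℝ)
    (hn : 1 ≤ n) (hnd : nd ≤ n) (hk : r + 1 ≤ k)
    (hβ : 0 < β) (hβγ : β < γ) (hγα : γ < α) (hα : α < 1)
    -- natural data, their augmentations and their labels
    (P : MeasureTheory.Measure (EuclideanSpace ℝ (Fin d))) [MeasureTheory.IsProbabilityMeasure P]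
    (A : ProbabilityTheory.Kernel (EuclideanSpace ℝ (Fin d)) (TempScaling.Sample r n))
    [ProbabilityTheory.IsMarkovKernel A]
    (y : EuclideanSpace ℝ (Fin d) → Fin (r + 1)) (hy : Measurable y)
    -- the data are class-balanced
    (hbal : ∀ i, P.real {xbar | y xbar = i} = 1 / ((r : ℝ) + 1))
    -- the augmentation graph is the similarity graph, normalized to total weight one
    (hw : ∀ x x', TempScaling.edgeWeight P A x x' =
      TempScaling.similarity nd α β γ x x' /
        ∑ u : TempScaling.Sample r n, ∑ v : TempScaling.Sample r n,
          TempScaling.similarity nd α β γ u v)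
    -- labels are recoverable from augmentations with error at most `δ`
    (hδ : ∃ g : TempScaling.Sample r n → Fin (r + 1),
      (P.compProd A).real {p | g p.2 ≠ y p.1} ≤ δ)
    -- `f` is a global minimizer of the temperature-scaled spectral contrastive loss
    (f : TempScaling.Sample r n → Fin k → ℝ)
    (hf : ∀ f' : TempScaling.Sample r n → Fin k → ℝ,
      TempScaling.tempLoss P A (TempScaling.temperature nd α β γ) f ≤
        TempScaling.tempLoss P A (TempScaling.temperature nd α β γ) f') :
    TempScaling.linearProbingError P A y f ≤
      4 * (1 - ((nd : ℝ) / n) ^ 2 + (γ / β) ^ 2 * ((nd : ℝ) / n) ^ 2) * δ /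
          (1 - (1 - α) / ((1 - α) + n * α + n * r * β)) + 8 * δ := by
  obtain ⟨g, hg⟩ := hδ
  have hδ0 : 0 ≤ δ := measureReal_nonneg.trans hg
  have hγ : 0 < γ := hβ.trans hβγ
  have hα0 : 0 < α := hγ.trans hγα
  have h2 : 0 < c₂ r n α β := c₂_pos hn hβ hα0 hα
  have h12 : c₂ r n α β ≤ c₁ r n nd α β γ := c₂_le_c₁ hβγ.le
  have h1 := h2.trans_le h12
  have hn' : (0 : ℝ) < n := by exact_mod_cast hn
  have hnd' : (nd : ℝ) ≤ n := by exact_mod_cast hnd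
  have hρ : 1 < γ / β := by rwa [one_lt_div hβ]
  obtain ⟨ρ, hρe⟩ : ∃ ρ, ρ = γ / β := ⟨_, rfl⟩
  obtain ⟨p, hpe⟩ : ∃ p : ℝ, p = nd / n := ⟨_, rfl⟩
  obtain ⟨σ, hσ⟩ : ∃ σ, σ = c₁ r n nd α β γ / c₂ r n α β := ⟨_, rfl⟩
  obtain ⟨a, ha⟩ : ∃ a, a = n * α / c₂ r n α β := ⟨_, rfl⟩
  obtain ⟨b, hb⟩ : ∃ b, b = n * r * β / c₂ r n α β := ⟨_, rfl⟩
  have hp0 : 0 ≤ p := by rw [hpe]; positivity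
  have hp1 : p ≤ 1 := by rw [hpe, div_le_one hn']; exact hnd'
  have ha0 : 0 < a := by rw [ha]; positivity
  have hb0 : 0 ≤ b := by rw [hb]; positivity
  have hab1 : 1 - (a + b) = (1 - α) / c₂ r n α β := by
    rw [ha, hb, ← add_div, eq_div_iff h2.ne', sub_mul, div_mul_cancel₀ _ h2.ne', c₂]
    ring
  have hab : a + b < 1 := by
    have : 0 < (1 - α) / c₂ r n α β := div_pos (by linarith) h2
    linarith
  have hgap : 1 - (1 - α) / ((1 - α) + n * α + n * r * β) = a + b := by
    have : (1 - α) / ((1 - α) + n * α + n * r * β) = 1 - (a + b) := hab1.symm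
    rw [this]; ring
  rw [hgap, ← hρe, ← hpe]
  rw [← hρe] at hρ
  obtain ⟨K, hK⟩ : ∃ K, K = 1 - p ^ 2 + ρ ^ 2 * p ^ 2 := ⟨_, rfl⟩
  rw [← hK]
  have hK0 : 0 ≤ K := by
    have : 0 ≤ p ^ 2 * (ρ ^ 2 - 1) := mul_nonneg (sq_nonneg p) (by nlinarith)
    rw [hK]; linarith
  have hrhs0 : 0 ≤ 4 * K * δ / (a + b) + 8 * δ := by positivity
  rcases Nat.eq_zero_or_pos r with hr0 | hr
  · -- with a single class every probe predicts the only label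
    subst hr0
    rw [linearProbingError_eq_zero_of_single_class]
    exact hrhs0
  -- the error is a probability, so the bound is trivial if it exceeds one
  rcases le_or_gt 1 (4 * K * δ / (a + b) + 8 * δ) with hbig | hsmall
  · exact (linearProbingError_le 0).trans (measureReal_le_one.trans hbig)
  have hr' : (1 : ℝ) ≤ r := by exact_mod_cast hr
  have hR : (0 : ℝ) < r + 1 := by positivity
  have hι : (Fintype.card (Fin (r + 1)) : ℝ) = r + 1 := by simp
  have hS := sum_sum_similarity_pos (r := r) hn hnd hβ hβγ hγα hα
  have hw0 : ∀ x, 0 ≤ vertexWeight P A x := fun x => by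
    rw [vertexWeight_eq hnd hw]
    split_ifs <;> positivity
  have hcls := sum_class_vertexWeight hn hnd hβ hβγ hγα hα hw
  have hcut := cut_inequality hr hn hnd hβ hβγ hγα hα hy hbal hw hcls g hg
  obtain ⟨G, hG⟩ : ∃ G, G =
      1 - (r + 1) * ∑ i, ∑ j, confusion Prod.fst g (vertexWeight P A) i j ^ 2 := ⟨_, rfl⟩
  rw [← hG, ← hσ, ← ha, ← hb] at hcut
  have hG0 : 0 ≤ G := by
    have := sum_confusion_sq_le (g := g) hR hι hw0 hcls
    rw [le_div_iff₀ hR] at this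
    rw [hG]; linarith
  have hG1 : G * (r + 1) ≤ r := by
    have := le_sum_confusion_sq (g := g) hR hι hcls
    rw [div_le_iff₀ (by positivity)] at this
    rw [hG]; linarith
  have hb' : 0 < b := by rw [hb]; positivity
  have hbr : b / r = n * β / c₂ r n α β := by rw [hb]; field_simp
  have hba : b * ρ ≤ r * a := by
    have : b * ρ = n * r * γ / c₂ r n α β := by rw [hb, hρe]; field_simp
    rw [this, ha, ← mul_div_assoc]
    refine div_le_div_of_nonneg_right ?_ h2.le
    have := mul_le_mul_of_nonneg_left hγα.le (by positivity : (0 : ℝ) ≤ n * r)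
    linarith
  have hσb : σ = 1 + b * (p * (ρ - 1)) := by
    rw [hσ, hb, hpe, hρe, div_eq_iff h2.ne']
    have : c₁ r n nd α β γ = c₂ r n α β + nd * r * (γ - β) := rfl
    rw [this]; field_simp
  have hT : 2 * K * (2 * δ) / (a + b) + 4 * (2 * δ) < 1 := by
    rw [show 2 * K * (2 * δ) = 4 * K * δ by ring]; linarith
  obtain ⟨hgap0, hmain⟩ := gini_add_misassigned_le hp0 hp1 hρ ha0 hb' hab hr' hba hσb hK
    (by positivity) hG0 hG1 hcut hT
  have herr := linearProbingError_le_of_minimizer hn hnd hk hβ hβγ hγα hα hy hbal hw hf g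
  have hbound : 2 * σ * (σ - 1) * (1 - α) * nd / ((α - β) * n ^ 2) =
      2 * σ * (1 - (a + b)) * p ^ 2 * (b * (ρ - 1)) / (a - b / r) := by
    have hαβ : 0 < α - β := by linarith
    have e1 : a - b / r = n * (α - β) / c₂ r n α β := by rw [hbr, ha]; ring
    rw [e1, hab1, hσb, hpe]
    field_simp
    ring
  rw [← hG, ← hσ, hbound] at herr
  have hfin : 2 * K * (2 * δ) / (a + b) + 4 * (2 * δ) = 4 * K * δ / (a + b) + 8 * δ := by ring
  linarith
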